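/- Let $F$ be an algebraically closed field with $\operatorname{char}(F)\neq 2,3$. For a group $G$ and a finite dimensional $G$-module $V$ over $F$, let $F[V]$ be the symmetric algebra of $V^*$ with its usual grading, let $F[V]^G$ be its subalgebra of $G$-invariant elements, where $g\in G$ acts on linear forms by $x^g(v)=x(gv)$, let $\beta(G,V)$ be the least $d\in\mathbb{N}$ such that the $F$-algebra $F[V]^G$ is generated by its homogeneous elements of degree at most $d$ ($\infty$ if there is no such $d$), and let $\beta(G)=\sup_V\beta(G,V)$, where $V$ runs through all finite dimensional $G$-modules over $F$. Let $\tilde A_4$ be the binary tetrahedral group, i.e. the group of the $24$ quaternions $\pm1,\pm i,\pm j,\pm k,\tfrac12(\pm1\pm i\pm j\pm k)$ under multiplication. Then its Noether number is $\beta(\tilde A_4)=12$. -/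

import Mathlib

open scoped Quaternion

noncomputable section

namespace NoetherNumber

universe u v

section Invariants

variable {F : Type u} {G : Type v} {V : Type u} [Field F] [Group G] [AddCommGroup V] [Module F V]

variable (F V) in
/-- The coordinate ring `F[V]` of `V`: the symmetric algebra of the dual space of `V`. -/
abbrev CoordRing : Type u := SymmetricAlgebra F (Module.Dual F V)

variable (F V) in
/-- The homogeneous component of degree `d` of `F[V]`: the span of the products of `d` linear
forms. -/
def homogeneousPart (d : ℕ) : Submodule F (CoordRing F V) :=
  (LinearMap.range (SymmetricAlgebra.ι F (Module.Dual F V))) ^ d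

/-- The operator `f ↦ f ^ g` on `F[V]`: the algebra endomorphism which sends a linear form `x` to
the linear form `v ↦ x (g v)`. -/
def act (ρ : Representation F G V) (g : G) : CoordRing F V →ₐ[F] CoordRing F V :=
  SymmetricAlgebra.lift (SymmetricAlgebra.ι F (Module.Dual F V) ∘ₗ (ρ g).dualMap)

/-- The algebra of polynomial invariants `F[V]^G`. -/
def invariants (ρ : Representation F G V) : Subalgebra F (CoordRing F V) where
  carrier := {f | ∀ g : G, act ρ g f = f}
  mul_mem' ha hb g := by rw [map_mul, ha g, hb g]
  add_mem' ha hb g := by rw [map_add, ha g, hb g]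
  algebraMap_mem' r g := AlgHom.commutes (act ρ g) r

/-- `F[V]^G` is generated, as an `F`-algebra, by its homogeneous elements of degree at most `d`. -/
def GeneratedInDegreeLE (ρ : Representation F G V) (d : ℕ) : Prop :=
  Algebra.adjoin F {f : CoordRing F V | f ∈ invariants ρ ∧ ∃ i ≤ d, f ∈ homogeneousPart F V i} =
    invariants ρ

/-- The Noether number `β(G, V)` of a `G`-module `V`: the least `d` such that `F[V]^G` is generated
by elements of degree at most `d` (and `⊤` if there is no such `d`). -/
def betaModule (ρ : Representation F G V) : ℕ∞ :=
  ⨅ (d : ℕ) (_ : GeneratedInDegreeLE ρ d), (d : ℕ∞)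

end Invariants

/-- The Noether number `β(G)` of a group `G` over `F`: the supremum of `β(G, V)` over all finite
dimensional `G`-modules `V` over `F`. (Each of them is isomorphic to one in the universe of `F`.) -/
def beta (F : Type u) (G : Type v) [Field F] [Group G] : ℕ∞ :=
  ⨆ (V : Type u) (_ : AddCommGroup V) (_ : Module F V) (_ : FiniteDimensional F V)
    (ρ : Representation F G V), betaModule ρ

/-- Four integers whose squares sum to `4` have the same parity. -/
theorem same_parity {a b c d : ℤ} (h : a ^ 2 + b ^ 2 + c ^ 2 + d ^ 2 = 4) :
    ∃ m n p : ℤ, b = a + 2 * m ∧ c = a + 2 * n ∧ d = a + 2 * p := by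
  have key : a % 2 = b % 2 ∧ a % 2 = c % 2 ∧ a % 2 = d % 2 := by
    have h4 := congrArg (· % 4) h
    rcases Int.even_or_odd' a with ⟨a', rfl | rfl⟩ <;>
    rcases Int.even_or_odd' b with ⟨b', rfl | rfl⟩ <;>
    rcases Int.even_or_odd' c with ⟨c', rfl | rfl⟩ <;>
    rcases Int.even_or_odd' d with ⟨d', rfl | rfl⟩ <;>
    ring_nf at h4 <;> omega
  exact ⟨(b - a) / 2, (c - a) / 2, (d - a) / 2, by omega, by omega, by omega⟩

/-- The binary tetrahedral group, as a group of unit quaternions: the quaternions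
`(a + b i + c j + d k) / 2` with integers `a, b, c, d` such that `a² + b² + c² + d² = 4`.
These are the 24 quaternions `±1, ±i, ±j, ±k` and `(±1 ± i ± j ± k) / 2`. -/
def binaryTetrahedral : Subgroup ℍ[ℝ]ˣ where
  carrier := {q | ∃ a b c d : ℤ, a ^ 2 + b ^ 2 + c ^ 2 + d ^ 2 = 4 ∧
    (q : ℍ[ℝ]).re = a / 2 ∧ (q : ℍ[ℝ]).imI = b / 2 ∧
    (q : ℍ[ℝ]).imJ = c / 2 ∧ (q : ℍ[ℝ]).imK = d / 2}
  one_mem' := ⟨2, 0, 0, 0, by norm_num, by simp⟩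
  mul_mem' := by
    rintro x y ⟨a, b, c, d, h, hx₁, hx₂, hx₃, hx₄⟩ ⟨a', b', c', d', h', hy₁, hy₂, hy₃, hy₄⟩
    obtain ⟨m, n, p, rfl, rfl, rfl⟩ := same_parity h
    obtain ⟨m', n', p', rfl, rfl, rfl⟩ := same_parity h'
    refine ⟨-(a * a') - a * (m' + n' + p') - a' * (m + n + p) - 2 * (m * m' + n * n' + p * p'),
      a * a' + a * m' + m * a' + a * p' + n * a' - a * n' - p * a' + 2 * (n * p' - p * n'),
      a * a' + a * n' + n * a' + a * m' + p * a' - a * p' - m * a' + 2 * (p * m' - m * p'),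
      a * a' + a * p' + p * a' + a * n' + m * a' - a * m' - n * a' + 2 * (m * n' - n * m'), ?_, ?_⟩
    · have hh := congrArg₂ (· * ·) h h'
      ring_nf at hh ⊢
      linarith
    · rw [Units.val_mul, Quaternion.re_mul, Quaternion.imI_mul, Quaternion.imJ_mul,
        Quaternion.imK_mul, hx₁, hx₂, hx₃, hx₄, hy₁, hy₂, hy₃, hy₄]
      push_cast
      exact ⟨by ring, by ring, by ring, by ring⟩
  inv_mem' := by
    rintro x ⟨a, b, c, d, h, h₁, h₂, h₃, h₄⟩
    have hR : (a : ℝ) ^ 2 + b ^ 2 + c ^ 2 + d ^ 2 = 4 := by exact_mod_cast h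
    have hinv : ((x⁻¹ : ℍ[ℝ]ˣ) : ℍ[ℝ]) = star (x : ℍ[ℝ]) := by
      refine Units.inv_eq_of_mul_eq_one_right ?_
      rw [Quaternion.self_mul_star, Quaternion.normSq_def', h₁, h₂, h₃, h₄]
      have : ((a : ℝ) / 2) ^ 2 + ((b : ℝ) / 2) ^ 2 + ((c : ℝ) / 2) ^ 2 + ((d : ℝ) / 2) ^ 2 = 1 := by
        linarith
      rw [this, Quaternion.coe_one]
    refine ⟨a, -b, -c, -d, by linarith, ?_⟩
    rw [hinv, Quaternion.re_star, Quaternion.imI_star, Quaternion.imJ_star, Quaternion.imK_star,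
      h₁, h₂, h₃, h₄]
    push_cast
    exact ⟨by ring, by ring, by ring, by ring⟩

end NoetherNumber

end

/-! Upper bound. Since 24 is invertible, every invariant is a multiple of its own average over the
group, so it suffices to put the averages of products of linear forms into the algebra `B` generated
by invariants of degree at most 12. The central element -1 splits the space L of linear forms into
its eigenspaces P and N. Averages of odd degree in N vanish, so only powers of W = P + N² matter,
and there the group acts through A₄. Degree 6 in W suffices (`reynolds_mem_of_mem_pow`), which is
degree at most 12 in L (`reynolds_mem`).

For A₄, the space W is the sum of the Klein-invariant part U and three weight spaces E, σE, σ²E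
permuted by an element σ of order 3. A product of weight vectors is Klein-invariant when the numbers
of factors from E, σE, σ²E have equal parity; its average is then a multiple of its transfer 1 + σ +
σ². A transfer of a product of four such balanced factors decomposes by Benson's identity
(`transfer_mul_four_mem`). Above degree 6 this misses only products of seven factors with none from
U, which need a separate argument (`transfer_degree_seven_mem`).

Lower bound. In a two-dimensional representation all homogeneous invariants of degree at most 11
take equal values at (1, 0) and (0, μ), where 2μ² = -1. The cube of the tetrahedral quartic is an
invariant of degree 12 separating these points. -/

open scoped Quaternion

noncomputable section

namespace NoetherNumber

universe u v

/-! ### Transfers for a cyclic group of order 3: reduction identities. -/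

section CyclicTransfer

variable {F A : Type*} [Field F] [CommRing A] [Algebra F A]

/-- The transfer `1 + σ + σ²` of an endomorphism `σ`. -/
def transfer (σ : A →ₐ[F] A) : A →ₗ[F] A :=
  LinearMap.id + σ.toLinearMap + σ.toLinearMap ∘ₗ σ.toLinearMap

theorem transfer_apply (σ : A →ₐ[F] A) (x : A) : transfer σ x = x + σ x + σ (σ x) := rfl

/-- The span of the products of `n` elements of `U`, `a` elements of `E`, `b` elements of `σ E` and
`c` elements of `σ² E`. -/
def multiPow (σ : A →ₐ[F] A) (U E : Submodule F A) (n a b c : ℕ) : Submodule F A :=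
  U ^ n * E ^ a * (E.map σ.toLinearMap) ^ b * ((E.map σ.toLinearMap).map σ.toLinearMap) ^ c

theorem multiPow_mul (σ : A →ₐ[F] A) (U E : Submodule F A) (n a b c n' a' b' c' : ℕ) :
    multiPow σ U E n a b c * multiPow σ U E n' a' b' c' =
      multiPow σ U E (n + n') (a + a') (b + b') (c + c') := by
  simp only [multiPow, pow_add]
  ring

/-- `m` is a sum of products of `d` factors in which the numbers of factors from `E`, `σ E`, `σ² E`
are given and have the same parity. -/
def IsBalanced (σ : A →ₐ[F] A) (U E : Submodule F A) (d : ℕ) (m : A) : Prop :=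
  ∃ n a b c : ℕ, a % 2 = b % 2 ∧ b % 2 = c % 2 ∧ n + a + b + c = d ∧ m ∈ multiPow σ U E n a b c

variable {σ : A →ₐ[F] A} {U E : Submodule F A}

theorem IsBalanced.mul {d e : ℕ} {x y : A} (hx : IsBalanced σ U E d x)
    (hy : IsBalanced σ U E e y) : IsBalanced σ U E (d + e) (x * y) := by
  obtain ⟨n, a, b, c, h₁, h₂, h₃, h⟩ := hx
  obtain ⟨n', a', b', c', h₁', h₂', h₃', h'⟩ := hy
  refine ⟨n + n', a + a', b + b', c + c', by omega, by omega, by omega, ?_⟩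
  rw [← multiPow_mul]
  exact Submodule.mul_mem_mul h h'

theorem map_multiPow_mem (hσ : ∀ x, σ (σ (σ x)) = x) (hU : U.map σ.toLinearMap ≤ U)
    {n a b c : ℕ} {x : A} (hx : x ∈ multiPow σ U E n a b c) :
    σ x ∈ multiPow σ U E n c a b := by
  have hE : ((E.map σ.toLinearMap).map σ.toLinearMap).map σ.toLinearMap = E := by
    rw [← Submodule.map_comp, ← Submodule.map_comp]
    have : (σ.toLinearMap ∘ₗ σ.toLinearMap) ∘ₗ σ.toLinearMap = LinearMap.id :=
      LinearMap.ext hσ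
    rw [this, Submodule.map_id]
  have h := Submodule.mem_map_of_mem (f := σ.toLinearMap) hx
  rw [multiPow, Submodule.map_mul, Submodule.map_mul, Submodule.map_mul, Submodule.map_pow,
    Submodule.map_pow, Submodule.map_pow, Submodule.map_pow, hE] at h
  have hle : U.map σ.toLinearMap ^ n * E.map σ.toLinearMap ^ a *
      (E.map σ.toLinearMap).map σ.toLinearMap ^ b * E ^ c ≤ multiPow σ U E n c a b := by
    calc _ = U.map σ.toLinearMap ^ n * (E ^ c * E.map σ.toLinearMap ^ a *
      (E.map σ.toLinearMap).map σ.toLinearMap ^ b) := by ring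
      _ ≤ U ^ n * (E ^ c * E.map σ.toLinearMap ^ a *
      (E.map σ.toLinearMap).map σ.toLinearMap ^ b) := by gcongr
      _ = _ := by rw [multiPow]; ring
  exact hle h

theorem IsBalanced.map (hσ : ∀ x, σ (σ (σ x)) = x) (hU : U.map σ.toLinearMap ≤ U)
    {d : ℕ} {x : A} (hx : IsBalanced σ U E d x) : IsBalanced σ U E d (σ x) := by
  obtain ⟨n, a, b, c, h₁, h₂, h₃, h⟩ := hx
  exact ⟨n, c, a, b, by omega, by omega, by omega, map_multiPow_mem hσ hU h⟩

theorem isBalanced_mul_of_mem {x y : A} (hx : x ∈ E) (hy : y ∈ E) :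
    IsBalanced σ U E 2 (x * y) := by
  refine ⟨0, 2, 0, 0, rfl, rfl, rfl, ?_⟩
  simpa [multiPow, pow_two] using Submodule.mul_mem_mul hx hy

theorem isBalanced_mul_map_mul_map {x y z : A} (hx : x ∈ E) (hy : y ∈ E) (hz : z ∈ E) :
    IsBalanced σ U E 3 (x * σ y * σ (σ z)) := by
  refine ⟨0, 1, 1, 1, rfl, rfl, rfl, ?_⟩
  simpa [multiPow] using Submodule.mul_mem_mul (Submodule.mul_mem_mul hx
    (Submodule.mem_map_of_mem (f := σ.toLinearMap) hy))
    (Submodule.mem_map_of_mem (f := σ.toLinearMap)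
      (Submodule.mem_map_of_mem (f := σ.toLinearMap) hz))

variable {B : Subalgebra F A} {d : ℕ}

/-- The element `transfer σ x` is fixed by `σ`, so it can be pulled out of the outer transfer. Every
later reduction writes a product as a combination of such terms `transfer σ x * y`. -/
theorem transfer_transfer_mul_mem (hσ : ∀ x, σ (σ (σ x)) = x)
    (ih : ∀ e < d, ∀ m, IsBalanced σ U E e m → transfer σ m ∈ B) {e₁ e₂ : ℕ} {x y : A}
    (hx : IsBalanced σ U E e₁ x) (hy : IsBalanced σ U E e₂ y) (h₁ : 0 < e₁) (h₂ : 0 < e₂)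
    (hd : e₁ + e₂ = d) : transfer σ (transfer σ x * y) ∈ B := by
  have : transfer σ (transfer σ x * y) = transfer σ x * transfer σ y := by
    simp only [transfer_apply, map_add, map_mul, hσ]
    ring
  rw [this]
  exact B.mul_mem (ih e₁ (by omega) x hx) (ih e₂ (by omega) y hy)

theorem mem_of_three_mul_mem (h3 : (3 : F) ≠ 0) {J : Submodule F A} {x : A} (h : 3 * x ∈ J) :
    x ∈ J := by
  have := J.smul_mem (3 : F)⁻¹ h
  rwa [show (3 : A) * x = (3 : F) • x by rw [Algebra.smul_def, map_ofNat],
    inv_smul_smul₀ h3] at this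

/-- Benson's trick: the sum over g mod 3 of (x - σ^g x)(y - σ^(g+1) y)(z - σ^(g+2) z) is zero, as
each summand has a vanishing factor. Expanding it expresses 3xyz through seven terms containing a
transfer. The factor `w` keeps the cofactor of transfer(x · σy · σ²z) of positive degree. -/
theorem transfer_mul_four_mem (hσ : ∀ x, σ (σ (σ x)) = x) (hU : U.map σ.toLinearMap ≤ U)
    (h3 : (3 : F) ≠ 0) (ih : ∀ e < d, ∀ m, IsBalanced σ U E e m → transfer σ m ∈ B)
    {e₁ e₂ e₃ e₄ : ℕ} {x y z w : A}
    (hx : IsBalanced σ U E e₁ x) (hy : IsBalanced σ U E e₂ y) (hz : IsBalanced σ U E e₃ z)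
    (hw : IsBalanced σ U E e₄ w) (h₁ : 0 < e₁) (h₂ : 0 < e₂) (h₃ : 0 < e₃) (h₄ : 0 < e₄)
    (hd : e₁ + e₂ + e₃ + e₄ = d) : transfer σ (x * y * z * w) ∈ B := by
  -- Elements whose transfer lies in `B`; all computations take place modulo `J`.
  let J : Submodule F A := (Subalgebra.toSubmodule B).comap (transfer σ)
  have key : ∀ {k l : ℕ} {u v : A}, IsBalanced σ U E k u → IsBalanced σ U E l v → 0 < k → 0 < l →
      k + l = d → transfer σ u * v ∈ J := fun hu hv hk hl h =>
    transfer_transfer_mul_mem hσ ih hu hv hk hl h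
  change x * y * z * w ∈ J
  refine mem_of_three_mul_mem h3 ?_
  have hy' := hy.map hσ hU
  have hz' := (hz.map hσ hU).map hσ hU
  have a₁ := key hx ((hy.mul hz).mul hw) h₁ (by omega) (by omega)
  have a₂ := key hy ((hx.mul hz).mul hw) h₂ (by omega) (by omega)
  have a₃ := key hz ((hx.mul hy).mul hw) h₃ (by omega) (by omega)
  have a₄ := key (hx.mul hy') (hz.mul hw) (by omega) (by omega) (by omega)
  have a₅ := key (hx.mul hz') (hy.mul hw) (by omega) (by omega) (by omega)
  have a₆ := key (hy'.mul hz') (hx.mul hw) (by omega) (by omega) (by omega)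
  have a₇ := key ((hx.mul hy').mul hz') hw (by omega) (by omega) (by omega)
  have := J.add_mem (J.sub_mem (J.sub_mem (J.sub_mem (J.add_mem (J.add_mem a₁ a₂) a₃) a₄) a₅) a₆) a₇
  convert this using 1
  simp only [transfer_apply, map_mul, hσ]
  ring

section DegreeSeven

variable (hσ : ∀ x, σ (σ (σ x)) = x) (hU : U.map σ.toLinearMap ≤ U) (h3 : (3 : F) ≠ 0)
  (ih : ∀ e < 7, ∀ m, IsBalanced σ U E e m → transfer σ m ∈ B)

include hσ hU h3 ih

theorem transfer_degree_seven_sub_mem {i j k l m p q : A} (hi : i ∈ E) (hj : j ∈ E) (hk : k ∈ E)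
    (hl : l ∈ E) (hm : m ∈ E) (hp : p ∈ E) (hq : q ∈ E) :
    transfer σ (i * σ j * σ (σ (k * l * m * p * q)) - i * l * m * σ (j * p * q) * σ (σ k)) ∈ B := by
  let J : Submodule F A := (Subalgebra.toSubmodule B).comap (transfer σ)
  have key : ∀ {k l : ℕ} {u v : A}, IsBalanced σ U E k u → IsBalanced σ U E l v → 0 < k → 0 < l →
      k + l = 7 → transfer σ u * v ∈ J := fun hu hv hk hl h =>
    transfer_transfer_mul_mem hσ ih hu hv hk hl h
  change _ ∈ J
  refine mem_of_three_mul_mem h3 ?_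
  have t : IsBalanced σ U E 3 (i * σ j * σ (σ k)) := isBalanced_mul_map_mul_map hi hj hk
  have u : IsBalanced σ U E 2 (l * m) := isBalanced_mul_of_mem hl hm
  have w : IsBalanced σ U E 2 (p * q) := isBalanced_mul_of_mem hp hq
  -- Put the nine products σ^a(lm) · σ^b(pq), times iσ(j)σ²(k), in a 3 × 3 array. Its row, column
  -- and cyclic diagonal sums lie in `J`. In the combination below only the entries (2, 2) and (0,
  -- 1) survive, with coefficients 3 and -3.
  have r₂ := key w (t.mul ((u.map hσ hU).map hσ hU)) (by omega) (by omega) (by omega)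
  have c₂ := key u (t.mul ((w.map hσ hU).map hσ hU)) (by omega) (by omega) (by omega)
  have d₀ := key (u.mul w) t (by omega) (by omega) (by omega)
  have r₀ := key w (t.mul u) (by omega) (by omega) (by omega)
  have c₁ := key u (t.mul (w.map hσ hU)) (by omega) (by omega) (by omega)
  have d₁ := key (u.mul (w.map hσ hU)) t (by omega) (by omega) (by omega)
  have := J.sub_mem (J.sub_mem (J.sub_mem (J.add_mem (J.add_mem r₂ c₂) d₀) r₀) c₁) d₁
  convert this using 1
  simp only [transfer_apply, map_mul, hσ]
  ring

/-- Modulo `J` the product is symmetric in `i`, `j`, `k`. Multiplying the transfer of iσ(j)σ²(k) by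
σ²(lmpq) gives three such products with `i`, `j`, `k` permuted, so their sum is three times the one
wanted. -/
theorem transfer_degree_seven_mem {i j k l m p q : A} (hi : i ∈ E) (hj : j ∈ E) (hk : k ∈ E)
    (hl : l ∈ E) (hm : m ∈ E) (hp : p ∈ E) (hq : q ∈ E) :
    transfer σ (i * σ j * σ (σ (k * l * m * p * q))) ∈ B := by
  let J : Submodule F A := (Subalgebra.toSubmodule B).comap (transfer σ)
  -- The subtracted product in `transfer_degree_seven_sub_mem` is symmetric in `i, l, m` and in `j,
  -- p, q`. Two instances sharing that product differ by an exchange: within the first triple for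
  -- `swap₁`, within the second for `swap₂`.
  have swap₁ : ∀ {i j k l m p q : A}, i ∈ E → j ∈ E → k ∈ E → l ∈ E → m ∈ E → p ∈ E → q ∈ E →
      i * σ j * σ (σ (k * l * m * p * q)) - k * σ j * σ (σ (i * l * m * p * q)) ∈ J := by
    intro i j k l m p q hi hj hk hl hm hp hq
    have h₁ : _ ∈ J := transfer_degree_seven_sub_mem hσ hU h3 ih hi hj hl hk hm hp hq
    have h₂ : _ ∈ J := transfer_degree_seven_sub_mem hσ hU h3 ih hk hj hl hi hm hp hq
    convert J.sub_mem h₁ h₂ using 1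
    simp only [map_mul]
    ring
  have swap₂ : ∀ {i j k l m p q : A}, i ∈ E → j ∈ E → k ∈ E → l ∈ E → m ∈ E → p ∈ E → q ∈ E →
      i * σ j * σ (σ (k * l * m * p * q)) - i * σ k * σ (σ (j * l * m * p * q)) ∈ J := by
    intro i j k l m p q hi hj hk hl hm hp hq
    have h₁ : _ ∈ J := transfer_degree_seven_sub_mem hσ hU h3 ih hi hj hl hp hm hk hq
    have h₂ : _ ∈ J := transfer_degree_seven_sub_mem hσ hU h3 ih hi hk hl hp hm hj hq
    convert J.sub_mem h₁ h₂ using 1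
    simp only [map_mul]
    ring
  change _ ∈ J
  refine mem_of_three_mul_mem h3 ?_
  have t : IsBalanced σ U E 3 (i * σ j * σ (σ k)) := isBalanced_mul_map_mul_map hi hj hk
  have v : IsBalanced σ U E 4 (σ (σ (l * m * (p * q)))) :=
    (((isBalanced_mul_of_mem hl hm).mul (isBalanced_mul_of_mem hp hq)).map hσ hU).map hσ hU
  have h₀ : _ ∈ J := transfer_transfer_mul_mem hσ ih t v (by omega) (by omega) (by omega)
  have a₁ := swap₁ hi hj hk hl hm hp hq
  have a₂ := swap₂ hk hj hi hl hm hp hq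
  have b₁ := swap₂ hi hj hk hl hm hp hq
  have b₂ := swap₁ hi hk hj hl hm hp hq
  convert J.add_mem (J.add_mem (J.add_mem (J.add_mem h₀ a₁) a₂) b₁) b₂ using 1
  simp only [transfer_apply, map_mul, hσ]
  ring

theorem transfer_degree_seven_mem' {i j k l m p q : A} (hi : i ∈ E) (hj : j ∈ E) (hk : k ∈ E)
    (hl : l ∈ E) (hm : m ∈ E) (hp : p ∈ E) (hq : q ∈ E) :
    transfer σ (i * l * m * σ (j * p * q) * σ (σ k)) ∈ B := by
  have h₁ := transfer_degree_seven_mem hσ hU h3 ih hi hj hk hl hm hp hq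
  have h₂ := transfer_degree_seven_sub_mem hσ hU h3 ih hi hj hk hl hm hp hq
  rw [map_sub] at h₂
  simpa using B.sub_mem h₁ h₂

end DegreeSeven

end CyclicTransfer

/-! ### Balanced products of degree above 6. -/

section CyclicTransfer

variable {F A : Type*} [Field F] [CommRing A] [Algebra F A]
variable {σ : A →ₐ[F] A} {U E : Submodule F A} {B : Subalgebra F A}

/-- Splits off one factor from U if there is one, and otherwise two factors from the same weight
space, which exist because three exponents sum to at least 4. The last clause makes the split cost
only 1 when possible, so that degree 7 with a factor from U still yields four pieces. -/
theorem exists_balanced_atom {n a b c : ℕ} (hab : a % 2 = b % 2) (hbc : b % 2 = c % 2)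
    (h : 1 ≤ n ∨ 4 ≤ n + a + b + c) :
    ∃ n' a' b' c' n₁ a₁ b₁ c₁ : ℕ, n = n' + n₁ ∧ a = a' + a₁ ∧ b = b' + b₁ ∧ c = c' + c₁ ∧
      a' % 2 = b' % 2 ∧ b' % 2 = c' % 2 ∧ 0 < n' + a' + b' + c' ∧ n' + a' + b' + c' ≤ 2 ∧
      (1 ≤ n → n' + a' + b' + c' = 1) := by
  rcases Nat.eq_zero_or_pos n with rfl | hn
  · by_cases ha : 2 ≤ a
    · exact ⟨0, 2, 0, 0, 0, a - 2, b, c, by omega⟩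
    by_cases hb : 2 ≤ b
    · exact ⟨0, 0, 2, 0, 0, a, b - 2, c, by omega⟩
    · exact ⟨0, 0, 0, 2, 0, a, b, c - 2, by omega⟩
  · exact ⟨1, 0, 0, 0, n - 1, a, b, c, by omega⟩

/-- As a `simp` lemma it peels the factors off an iterated product one at a time, from the right. -/
theorem mul_le_iff_forall_le_comap {M N J : Submodule F A} :
    M * N ≤ J ↔ ∀ n ∈ N, M ≤ J.comap (LinearMap.mulRight F n) := by
  rw [Submodule.mul_le]
  exact ⟨fun h n hn m hm => h m hm n hn, fun h m hm n hn => h n hn hm⟩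

theorem transfer_mem_of_isBalanced (hσ : ∀ x, σ (σ (σ x)) = x) (hU : U.map σ.toLinearMap ≤ U)
    (h3 : (3 : F) ≠ 0) (h6 : ∀ d ≤ 6, ∀ m, IsBalanced σ U E d m → transfer σ m ∈ B)
    (d : ℕ) (m : A) (hm : IsBalanced σ U E d m) : transfer σ m ∈ B := by
  induction d using Nat.strong_induction_on generalizing m with
  | _ d ih =>
  rcases Nat.lt_or_ge 6 d with hd | hd
  swap
  · exact h6 d hd m hm
  let J : Submodule F A := (Subalgebra.toSubmodule B).comap (transfer σ)
  have rot : ∀ x, transfer σ (σ x) ∈ B → transfer σ x ∈ B := by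
    intro x hx
    convert hx using 1
    simp only [transfer_apply, hσ]
    ring
  obtain ⟨n, a, b, c, hab, hbc, hs, hm⟩ := hm
  -- Here `a`, `b`, `c` are odd with sum 7, and balanced pieces have degree at least 2, so four of
  -- them do not fit. Up to rotation by `σ` the exponents are (1, 1, 5) or (3, 3, 1).
  by_cases h7 : n = 0 ∧ d = 7
  · obtain ⟨rfl, rfl⟩ := h7
    have h115 : multiPow σ U E 0 1 1 5 ≤ J := by
      have : multiPow σ U E 0 1 1 5 = E * E.map σ.toLinearMap *
          (E.map σ.toLinearMap).map σ.toLinearMap * (E.map σ.toLinearMap).map σ.toLinearMap *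
          (E.map σ.toLinearMap).map σ.toLinearMap * (E.map σ.toLinearMap).map σ.toLinearMap *
          (E.map σ.toLinearMap).map σ.toLinearMap := by
        rw [multiPow]
        ring
      rw [this]
      simp only [mul_le_iff_forall_le_comap]
      rintro _ ⟨_, ⟨k, hk, rfl⟩, rfl⟩ _ ⟨_, ⟨l, hl, rfl⟩, rfl⟩ _ ⟨_, ⟨m, hm, rfl⟩, rfl⟩
        _ ⟨_, ⟨p, hp, rfl⟩, rfl⟩ _ ⟨_, ⟨q, hq, rfl⟩, rfl⟩ _ ⟨j, hj, rfl⟩ i hi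
      have : _ ∈ J := transfer_degree_seven_mem hσ hU h3 ih hi hj hk hl hm hp hq
      simp only [Submodule.mem_comap, LinearMap.mulRight_apply, AlgHom.toLinearMap_apply]
      convert this using 1
      simp only [map_mul]
      ring
    have h331 : multiPow σ U E 0 3 3 1 ≤ J := by
      have : multiPow σ U E 0 3 3 1 = E * E * E * E.map σ.toLinearMap *
          E.map σ.toLinearMap * E.map σ.toLinearMap *
          (E.map σ.toLinearMap).map σ.toLinearMap := by
        rw [multiPow]
        ring
      rw [this]
      simp only [mul_le_iff_forall_le_comap]
      rintro _ ⟨_, ⟨k, hk, rfl⟩, rfl⟩ _ ⟨l, hl, rfl⟩ _ ⟨m, hm, rfl⟩ _ ⟨p, hp, rfl⟩ q hq j hj i hi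
      have : _ ∈ J := transfer_degree_seven_mem' hσ hU h3 ih hi hl hk hj hq hm hp
      simp only [Submodule.mem_comap, LinearMap.mulRight_apply, AlgHom.toLinearMap_apply]
      convert this using 1
      simp only [map_mul]
      ring
    have e : (a = 1 ∧ b = 1 ∧ c = 5) ∨ (a = 1 ∧ b = 5 ∧ c = 1) ∨ (a = 5 ∧ b = 1 ∧ c = 1) ∨
        (a = 3 ∧ b = 3 ∧ c = 1) ∨ (a = 3 ∧ b = 1 ∧ c = 3) ∨ (a = 1 ∧ b = 3 ∧ c = 3) := by
      have ha : a = 1 ∨ a = 3 ∨ a = 5 := by omega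
      have hb : b = 1 ∨ b = 3 ∨ b = 5 := by omega
      rcases ha with rfl | rfl | rfl <;> rcases hb with rfl | rfl | rfl <;> omega
    have hm₁ := map_multiPow_mem hσ hU hm
    have hm₂ := map_multiPow_mem hσ hU hm₁
    rcases e with ⟨rfl, rfl, rfl⟩ | ⟨rfl, rfl, rfl⟩ | ⟨rfl, rfl, rfl⟩ | ⟨rfl, rfl, rfl⟩ |
      ⟨rfl, rfl, rfl⟩ | ⟨rfl, rfl, rfl⟩
    · exact h115 hm
    · exact rot _ (h115 hm₁)
    · exact rot _ (rot _ (h115 hm₂))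
    · exact h331 hm
    · exact rot _ (h331 hm₁)
    · exact rot _ (rot _ (h331 hm₂))
  -- Three cheap pieces always leave a nonempty fourth: either the degree is at least 8 = 2 + 2 + 2
  -- + 2, or the first piece has degree 1.
  · obtain ⟨n₁, a₁, b₁, c₁, n, a, b, c, rfl, rfl, rfl, rfl, k₁, k₂, k₃, k₄, k₅⟩ :=
      exists_balanced_atom hab hbc (n := n) (by omega)
    obtain ⟨n₂, a₂, b₂, c₂, n, a, b, c, rfl, rfl, rfl, rfl, l₁, l₂, l₃, l₄, -⟩ :=
      exists_balanced_atom (n := n) (a := a) (b := b) (c := c) (by omega) (by omega) (by omega)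
    obtain ⟨n₃, a₃, b₃, c₃, n, a, b, c, rfl, rfl, rfl, rfl, m₁, m₂, m₃, m₄, -⟩ :=
      exists_balanced_atom (n := n) (a := a) (b := b) (c := c) (by omega) (by omega) (by omega)
    have : multiPow σ U E n₁ a₁ b₁ c₁ * multiPow σ U E n₂ a₂ b₂ c₂ * multiPow σ U E n₃ a₃ b₃ c₃ *
        multiPow σ U E n a b c ≤ J := by
      simp only [mul_le_iff_forall_le_comap]
      intro w hw z hz y hy x hx
      exact transfer_mul_four_mem hσ hU h3 ih
        ⟨n₁, a₁, b₁, c₁, k₁, k₂, rfl, hx⟩ ⟨n₂, a₂, b₂, c₂, l₁, l₂, rfl, hy⟩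
        ⟨n₃, a₃, b₃, c₃, m₁, m₂, rfl, hz⟩ ⟨n, a, b, c, by omega, by omega, rfl, hw⟩
        k₃ l₃ m₃ (by omega) (by omega)
    refine this ?_
    rw [multiPow_mul, multiPow_mul, multiPow_mul]
    convert hm using 1
    simp only [add_assoc]

end CyclicTransfer

/-! ### Averaging operators, weight spaces and degree filtrations. -/

section Operators

variable {F A : Type*} [Field F] [CommRing A] [Algebra F A]

/-- The relations satisfied by the operators by which the elements `i`, `j`, an element of order `3`
with `i ↦ j ↦ k` under conjugation, and `-1` of the binary tetrahedral group act on the right. -/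
structure IsTetrahedral (α β σ ζ : A →ₐ[F] A) : Prop where
  cube : ∀ x, σ (σ (σ x)) = x
  apply_left_sigma : ∀ x, α (σ x) = σ (β x)
  apply_right_sigma : ∀ x, β (σ x) = σ (β (α x))
  left_sq : ∀ x, α (α x) = ζ x
  right_sq : ∀ x, β (β x) = ζ x
  swap : ∀ x, β (α x) = α (β (ζ x))
  zeta_left : ∀ x, ζ (α x) = α (ζ x)
  zeta_right : ∀ x, ζ (β x) = β (ζ x)
  zeta_sigma : ∀ x, ζ (σ x) = σ (ζ x)
  zeta_sq : ∀ x, ζ (ζ x) = x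

/-- The sum of all operators in the group generated by a tetrahedral quadruple. -/
def reynolds (α β σ ζ : A →ₐ[F] A) : A →ₗ[F] A :=
  transfer σ ∘ₗ (LinearMap.id + α.toLinearMap) ∘ₗ (LinearMap.id + β.toLinearMap) ∘ₗ
    (LinearMap.id + ζ.toLinearMap)

theorem reynolds_apply (α β σ ζ : A →ₐ[F] A) (x : A) : reynolds α β σ ζ x =
    transfer σ ((x + ζ x) + β (x + ζ x) + α ((x + ζ x) + β (x + ζ x))) := rfl

variable {α β σ ζ : A →ₐ[F] A}

theorem IsTetrahedral.transfer_fixed (h : IsTetrahedral α β σ ζ) {x : A} (hα : α x = x)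
    (hβ : β x = x) : α (transfer σ x) = transfer σ x ∧ σ (transfer σ x) = transfer σ x := by
  have e₁ : α (σ x) = σ x := by rw [h.apply_left_sigma, hβ]
  have e₂ : β (σ x) = σ x := by rw [h.apply_right_sigma, hα, hβ]
  have e₃ : α (σ (σ x)) = σ (σ x) := by rw [h.apply_left_sigma, e₂]
  simp only [transfer_apply, map_add, h.cube, hα, e₁, e₃, true_and]
  ring

theorem IsTetrahedral.reynolds_fixed (h : IsTetrahedral α β σ ζ) (x : A) :
    α (reynolds α β σ ζ x) = reynolds α β σ ζ x ∧ σ (reynolds α β σ ζ x) = reynolds α β σ ζ x := by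
  rw [reynolds_apply]
  apply h.transfer_fixed
  · simp only [map_add, h.left_sq, h.zeta_right, h.zeta_sq]
    ring
  · simp only [map_add, h.swap, h.right_sq, h.zeta_right, h.zeta_sq]
    ring

theorem IsTetrahedral.reynolds_of_fixed (h : IsTetrahedral α β σ ζ) {x : A} (hα : α x = x)
    (hσ : σ x = x) : reynolds α β σ ζ x = (24 : F) • x := by
  have hζ : ζ x = x := by rw [← h.left_sq, hα, hα]
  have hβ : β x = x := by
    have := h.apply_left_sigma x
    rw [hσ, hα] at this
    rw [← h.cube (β x), ← this, hσ, hσ]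
  simp only [reynolds_apply, transfer_apply, map_add, hα, hσ, hζ, hβ, Algebra.smul_def, map_ofNat]
  ring

theorem IsTetrahedral.map_reynolds_le (h : IsTetrahedral α β σ ζ) {M : Submodule F A}
    (hα : M.map α.toLinearMap ≤ M) (hβ : M.map β.toLinearMap ≤ M) (hσ : M.map σ.toLinearMap ≤ M)
    {x : A} (hx : x ∈ M) : reynolds α β σ ζ x ∈ M := by
  have a : ∀ y ∈ M, α y ∈ M := fun y hy => hα (Submodule.mem_map_of_mem hy)
  have b : ∀ y ∈ M, β y ∈ M := fun y hy => hβ (Submodule.mem_map_of_mem hy)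
  have s : ∀ y ∈ M, σ y ∈ M := fun y hy => hσ (Submodule.mem_map_of_mem hy)
  have z : ∀ y ∈ M, ζ y ∈ M := fun y hy => by rw [← h.left_sq]; exact a _ (a _ hy)
  have h₁ := M.add_mem hx (z x hx)
  have h₂ := M.add_mem h₁ (b _ h₁)
  have h₃ := M.add_mem h₂ (a _ h₂)
  exact M.add_mem (M.add_mem h₃ (s _ h₃)) (s _ (s _ h₃))

/-- The eigenspace of an algebra endomorphism for the eigenvalue `ε`. -/
def eigen (φ : A →ₐ[F] A) (ε : F) : Submodule F A := LinearMap.ker (φ.toLinearMap - ε •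
        LinearMap.id)

theorem mem_eigen {φ : A →ₐ[F] A} {ε : F} {x : A} : x ∈ eigen φ ε ↔ φ x = ε • x := by
  simp [eigen, sub_eq_zero]

theorem eigen_mul_le (φ : A →ₐ[F] A) (ε δ : F) : eigen φ ε * eigen φ δ ≤ eigen φ (ε * δ) := by
  rw [Submodule.mul_le]
  intro x hx y hy
  rw [mem_eigen] at *
  rw [map_mul, hx, hy, smul_mul_smul_comm]

theorem eigen_pow_le (φ : A →ₐ[F] A) (ε : F) (n : ℕ) : eigen φ ε ^ n ≤ eigen φ (ε ^ n) := by
  induction n with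
  | zero =>
    rw [pow_zero, pow_zero, Submodule.one_le, mem_eigen]
    simp
  | succ n ih =>
    rw [pow_succ, pow_succ]
    exact (mul_le_mul_left ih _).trans (eigen_mul_le φ _ _)

theorem multiPow_le_eigen {φ : A →ₐ[F] A} {U E : Submodule F A} {ε₀ ε₁ ε₂ ε₃ : F}
    (h₀ : U ≤ eigen φ ε₀) (h₁ : E ≤ eigen φ ε₁) (h₂ : E.map σ.toLinearMap ≤ eigen φ ε₂)
    (h₃ : (E.map σ.toLinearMap).map σ.toLinearMap ≤ eigen φ ε₃) (n a b c : ℕ) :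
    multiPow σ U E n a b c ≤ eigen φ (ε₀ ^ n * ε₁ ^ a * ε₂ ^ b * ε₃ ^ c) := by
  have k₀ := (pow_le_pow_left' h₀ n).trans (eigen_pow_le φ ε₀ n)
  have k₁ := (pow_le_pow_left' h₁ a).trans (eigen_pow_le φ ε₁ a)
  have k₂ := (pow_le_pow_left' h₂ b).trans (eigen_pow_le φ ε₂ b)
  have k₃ := (pow_le_pow_left' h₃ c).trans (eigen_pow_le φ ε₃ c)
  exact (mul_le_mul' ((mul_le_mul' ((mul_le_mul' k₀ k₁).trans (eigen_mul_le φ _ _)) k₂).trans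
    (eigen_mul_le φ _ _)) k₃).trans (eigen_mul_le φ _ _)

/-- A multinomial expansion. The extra factor `multiPow` absorbs one summand at each step of the
induction on `k`. -/
theorem mul_pow_le_of_multiPow_le {U E Q : Submodule F A}
    (h : ∀ n a b c, multiPow σ U E n a b c ≤ Q) (k n a b c : ℕ) :
    multiPow σ U E n a b c *
      (U ⊔ E ⊔ E.map σ.toLinearMap ⊔ (E.map σ.toLinearMap).map σ.toLinearMap) ^ k ≤ Q := by
  induction k generalizing n a b c with
  | zero => simpa using h n a b c
  | succ k ih =>
    have h₀ : multiPow σ U E n a b c * U = multiPow σ U E (n + 1) a b c := by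
      simp only [multiPow, pow_succ]
      ring
    have h₁ : multiPow σ U E n a b c * E = multiPow σ U E n (a + 1) b c := by
      simp only [multiPow, pow_succ]
      ring
    have h₂ : multiPow σ U E n a b c * E.map σ.toLinearMap = multiPow σ U E n a (b + 1) c := by
      simp only [multiPow, pow_succ]
      ring
    have h₃ : multiPow σ U E n a b c * (E.map σ.toLinearMap).map σ.toLinearMap =
        multiPow σ U E n a b (c + 1) := by
      simp only [multiPow, pow_succ]
      ring
    rw [pow_succ', ← mul_assoc, Submodule.mul_sup, Submodule.mul_sup, Submodule.mul_sup,
      Submodule.sup_mul, Submodule.sup_mul, Submodule.sup_mul, h₀, h₁, h₂, h₃]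
    exact sup_le (sup_le (sup_le (ih _ _ _ _) (ih _ _ _ _)) (ih _ _ _ _)) (ih _ _ _ _)

theorem mul_pow_le_of_pow_mul_pow_le {M N Q : Submodule F A} (h : ∀ p q, M ^ p * N ^ q ≤ Q)
    (k p q : ℕ) : M ^ p * N ^ q * (M ⊔ N) ^ k ≤ Q := by
  induction k generalizing p q with
  | zero => simpa using h p q
  | succ k ih =>
    rw [pow_succ', ← mul_assoc, Submodule.mul_sup, Submodule.sup_mul]
    refine sup_le ?_ ?_
    · convert ih (p + 1) q using 2
      ring
    · convert ih p (q + 1) using 2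
      ring

/-- The filtration by degree defined by a space `L` of elements of degree `1`. -/
def degreeLE (L : Submodule F A) (n : ℕ) : Submodule F A := ⨆ j ≤ n, L ^ j

theorem pow_le_degreeLE (L : Submodule F A) {j n : ℕ} (h : j ≤ n) : L ^ j ≤ degreeLE L n :=
  le_iSup₂_of_le j h le_rfl

theorem degreeLE_mul_le (L : Submodule F A) (m n : ℕ) :
    degreeLE L m * degreeLE L n ≤ degreeLE L (m + n) := by
  simp only [degreeLE, Submodule.iSup_mul, Submodule.mul_iSup, iSup_le_iff]
  intro i hi j hj
  rw [← pow_add]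
  exact pow_le_degreeLE L (by omega)

theorem degreeLE_pow_le (L : Submodule F A) (m n : ℕ) :
    degreeLE L m ^ n ≤ degreeLE L (m * n) := by
  induction n with
  | zero => simpa using pow_le_degreeLE L (le_refl 0)
  | succ n ih =>
    rw [pow_succ, mul_add, mul_one]
    exact (mul_le_mul_left ih _).trans (degreeLE_mul_le L _ _)

theorem degreeLE_mono (L : Submodule F A) {m n : ℕ} (h : m ≤ n) : degreeLE L m ≤ degreeLE L n :=
  iSup₂_le fun _ hj => pow_le_degreeLE L (hj.trans h)

end Operators

/-! ### Reduction from the binary tetrahedral group to A₄ and to transfers. -/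

section Operators

variable {F A : Type*} [Field F] [CommRing A] [Algebra F A] {α β σ ζ : A →ₐ[F] A}

theorem map_inf_eigen_le {φ ψ : A →ₐ[F] A} (h : ∀ x, ψ (φ x) = φ (ψ x)) {L : Submodule F A}
    (hL : L.map φ.toLinearMap ≤ L) (ε : F) :
    (L ⊓ eigen ψ ε).map φ.toLinearMap ≤ L ⊓ eigen ψ ε := by
  rintro _ ⟨x, ⟨hx, hx'⟩, rfl⟩
  refine ⟨hL (Submodule.mem_map_of_mem hx), ?_⟩
  rw [SetLike.mem_coe, mem_eigen] at *
  rw [AlgHom.toLinearMap_apply, h, hx', map_smul]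

theorem le_sup_inf_eigen (h2 : (2 : F) ≠ 0) {ψ : A →ₐ[F] A} {L : Submodule F A}
    (hL : L.map ψ.toLinearMap ≤ L) (hψ : ∀ x ∈ L, ψ (ψ x) = x) :
    L ≤ L ⊓ eigen ψ 1 ⊔ L ⊓ eigen ψ (-1) := by
  intro x hx
  have hx' : ψ x ∈ L := hL (Submodule.mem_map_of_mem hx)
  have e : x = (2 : F)⁻¹ • (x + ψ x) + (2 : F)⁻¹ • (x - ψ x) := by
    rw [← smul_add, add_add_sub_cancel, ← two_smul F x, inv_smul_smul₀ h2]
  rw [e]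
  refine Submodule.add_mem_sup (Submodule.smul_mem _ _ ⟨L.add_mem hx hx', ?_⟩)
    (Submodule.smul_mem _ _ ⟨L.sub_mem hx hx', ?_⟩)
  · rw [SetLike.mem_coe, mem_eigen, map_add, hψ x hx, one_smul, add_comm]
  · rw [SetLike.mem_coe, mem_eigen, map_sub, hψ x hx, neg_one_smul, neg_sub]

/-- On `W` the operators `α` and `β` are commuting involutions, so `W` is the sum of four joint
eigenspaces. The nontrivial ones form one orbit of `σ`: the signs of (`α`, `β`) on E, σE, σ²E are
(1, -1), (-1, -1), (-1, 1). -/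
theorem IsTetrahedral.le_sup_weights (h : IsTetrahedral α β σ ζ) (h2 : (2 : F) ≠ 0)
    {W : Submodule F A} (hα : W.map α.toLinearMap ≤ W) (hβ : W.map β.toLinearMap ≤ W)
    (hσ : W.map σ.toLinearMap ≤ W) (hζ : ∀ x ∈ W, ζ x = x) :
    W ≤ W ⊓ eigen α 1 ⊓ eigen β 1 ⊔ W ⊓ eigen α 1 ⊓ eigen β (-1) ⊔
      (W ⊓ eigen α 1 ⊓ eigen β (-1)).map σ.toLinearMap ⊔
      ((W ⊓ eigen α 1 ⊓ eigen β (-1)).map σ.toLinearMap).map σ.toLinearMap := by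
  have s : ∀ y ∈ W, σ y ∈ W := fun y hy => hσ (Submodule.mem_map_of_mem hy)
  have b : ∀ y ∈ W, β y ∈ W := fun y hy => hβ (Submodule.mem_map_of_mem hy)
  have split : ∀ ε : F, W ⊓ eigen α ε ≤
      (W ⊓ eigen α ε) ⊓ eigen β 1 ⊔ (W ⊓ eigen α ε) ⊓ eigen β (-1) := by
    intro ε
    apply le_sup_inf_eigen h2
    · rintro _ ⟨x, ⟨hx, hx'⟩, rfl⟩
      refine ⟨b x hx, ?_⟩
      rw [SetLike.mem_coe, mem_eigen] at *
      have := h.swap x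
      rw [hζ x hx] at this
      rw [AlgHom.toLinearMap_apply, ← this, hx', map_smul]
    · rintro x ⟨hx, -⟩
      rw [h.right_sq, hζ x hx]
  have split' : W ≤ W ⊓ eigen α 1 ⊔ W ⊓ eigen α (-1) :=
    le_sup_inf_eigen h2 hα fun x hx => by rw [h.left_sq, hζ x hx]
  refine (split'.trans (sup_le_sup (split 1) (split (-1)))).trans ?_
  refine sup_le (le_sup_of_le_left le_sup_left) (sup_le (le_sup_of_le_right ?_)
    (le_sup_of_le_left (le_sup_of_le_right ?_)))
  · rintro x ⟨⟨hx, hx₁⟩, hx₂⟩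
    rw [SetLike.mem_coe, mem_eigen] at hx₁ hx₂
    -- Since `σ` has order 3, x = σ²(σx) and σx lies in E.
    refine ⟨σ (σ x), ⟨σ x, ⟨⟨s x hx, ?_⟩, ?_⟩, rfl⟩, h.cube x⟩
    · rw [SetLike.mem_coe, mem_eigen, h.apply_left_sigma, hx₂, map_smul]
    · rw [SetLike.mem_coe, mem_eigen, h.apply_right_sigma, hx₁, map_smul, hx₂, one_smul, map_smul]
  · rintro x ⟨⟨hx, hx₁⟩, hx₂⟩
    rw [SetLike.mem_coe, mem_eigen] at hx₁ hx₂
    refine ⟨σ (σ x), ⟨⟨s _ (s x hx), ?_⟩, ?_⟩, h.cube x⟩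
    · rw [SetLike.mem_coe, mem_eigen, h.apply_left_sigma, h.apply_right_sigma, hx₁, map_smul, hx₂]
      simp
    · rw [SetLike.mem_coe, mem_eigen, h.apply_right_sigma, h.apply_left_sigma, h.apply_right_sigma,
        hx₂]
      simp [hx₁, hx₂]

theorem IsTetrahedral.weights_le (h : IsTetrahedral α β σ ζ) {W : Submodule F A}
    {E : Submodule F A} (hE : E = W ⊓ eigen α 1 ⊓ eigen β (-1)) :
    (E ≤ eigen α 1 ∧ E.map σ.toLinearMap ≤ eigen α (-1) ∧
      (E.map σ.toLinearMap).map σ.toLinearMap ≤ eigen α (-1)) ∧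
    (E ≤ eigen β (-1) ∧ E.map σ.toLinearMap ≤ eigen β (-1) ∧
      (E.map σ.toLinearMap).map σ.toLinearMap ≤ eigen β 1) := by
  have a : ∀ x ∈ E, α x = x := fun x hx => by
    rw [hE] at hx
    simpa using mem_eigen.1 hx.1.2
  have b : ∀ x ∈ E, β x = -x := fun x hx => by
    rw [hE] at hx
    simpa using mem_eigen.1 hx.2
  refine ⟨⟨?_, ?_, ?_⟩, ?_, ?_, ?_⟩
  · intro x hx
    simp [mem_eigen, a x hx]
  · rintro _ ⟨x, hx, rfl⟩
    simp [mem_eigen, h.apply_left_sigma, b x hx]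
  · rintro _ ⟨_, ⟨x, hx, rfl⟩, rfl⟩
    simp [mem_eigen, h.apply_left_sigma, h.apply_right_sigma, a x hx, b x hx]
  · intro x hx
    simp [mem_eigen, b x hx]
  · rintro _ ⟨x, hx, rfl⟩
    simp [mem_eigen, h.apply_right_sigma, a x hx, b x hx]
  · rintro _ ⟨_, ⟨x, hx, rfl⟩, rfl⟩
    simp [mem_eigen, h.apply_left_sigma, h.apply_right_sigma, a x hx, b x hx]

/-- The alternatives follow the order in which `reynolds` applies 1 + ζ, 1 + β and 1 + α: each
factor kills the eigenvalue -1. -/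
theorem reynolds_eq_zero {x : A} (h : ζ x = -x ∨ (ζ x = x ∧ β x = -x) ∨
    (ζ x = x ∧ β x = x ∧ α x = -x)) : reynolds α β σ ζ x = 0 := by
  rcases h with h | ⟨h, h'⟩ | ⟨h, h', h''⟩ <;> rw [reynolds_apply]
  · simp [h]
  · simp [h, h']
  · simp only [h, h', h'', map_add α, map_add β]
    rw [show x + x + (x + x) + (-x + -x + (-x + -x)) = 0 by ring, map_zero]

theorem reynolds_eq_smul_transfer {x : A} (hζ : ζ x = x) (hα : α x = x) (hβ : β x = x) :
    reynolds α β σ ζ x = (8 : F) • transfer σ x := by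
  have : x + x + (x + x) + (x + x + (x + x)) = (8 : F) • x := by
    rw [Algebra.smul_def, map_ofNat]
    ring
  rw [reynolds_apply, ← map_smul, ← this]
  simp only [map_add α, map_add β, hζ, hα, hβ]

theorem apply_eq_or_of_mem_eigen {φ : A →ₐ[F] A} {k : ℕ} {x : A} (h : x ∈ eigen φ ((-1) ^ k)) :
    (k % 2 = 0 → φ x = x) ∧ (k % 2 = 1 → φ x = -x) := by
  rw [mem_eigen] at h
  refine ⟨fun hk => ?_, fun hk => ?_⟩
  · rwa [(Nat.even_iff.2 hk).neg_one_pow, one_smul] at h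
  · rwa [(Nat.odd_iff.2 hk).neg_one_pow, neg_one_smul] at h

/-- If `W` is a space of elements fixed by `ζ`, then the invariants in the algebra generated by `W`
are generated by those of degree at most `6` in `W`. -/
theorem IsTetrahedral.reynolds_mem_of_mem_pow (h : IsTetrahedral α β σ ζ) (h2 : (2 : F) ≠ 0)
    (h3 : (3 : F) ≠ 0) {W : Submodule F A} (hα : W.map α.toLinearMap ≤ W)
    (hβ : W.map β.toLinearMap ≤ W) (hσ : W.map σ.toLinearMap ≤ W) (hζ : W ≤ eigen ζ 1)
    {B : Subalgebra F A} (hB : ∀ j ≤ 6, ∀ x ∈ W ^ j, reynolds α β σ ζ x ∈ B) (k : ℕ) :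
    W ^ k ≤ (Subalgebra.toSubmodule B).comap (reynolds α β σ ζ) := by
  have hζ' : ∀ x ∈ W, ζ x = x := fun x hx => by simpa using mem_eigen.1 (hζ hx)
  have hW := h.le_sup_weights h2 hα hβ hσ hζ'
  obtain ⟨⟨a₁, a₂, a₃⟩, b₁, b₂, b₃⟩ := h.weights_le (W := W) rfl
  have hUα : W ⊓ eigen α 1 ⊓ eigen β 1 ≤ eigen α 1 := inf_le_left.trans inf_le_right
  have hUβ : W ⊓ eigen α 1 ⊓ eigen β 1 ≤ eigen β 1 := inf_le_right
  have hUσ : (W ⊓ eigen α 1 ⊓ eigen β 1).map σ.toLinearMap ≤ W ⊓ eigen α 1 ⊓ eigen β 1 := by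
    rintro _ ⟨x, ⟨⟨hx, hx₁⟩, hx₂⟩, rfl⟩
    rw [SetLike.mem_coe, mem_eigen, one_smul] at hx₁ hx₂
    refine ⟨⟨hσ (Submodule.mem_map_of_mem hx), ?_⟩, ?_⟩
    · rw [SetLike.mem_coe, mem_eigen, AlgHom.toLinearMap_apply, h.apply_left_sigma, hx₂, one_smul]
    · rw [SetLike.mem_coe, mem_eigen, AlgHom.toLinearMap_apply, h.apply_right_sigma, hx₁, hx₂,
        one_smul]
  have hUW : W ⊓ eigen α 1 ⊓ eigen β 1 ≤ W := inf_le_left.trans inf_le_left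
  have hEW : W ⊓ eigen α 1 ⊓ eigen β (-1) ≤ W := inf_le_left.trans inf_le_left
  generalize W ⊓ eigen α 1 ⊓ eigen β 1 = U at *
  generalize W ⊓ eigen α 1 ⊓ eigen β (-1) = E at *
  have hE₂ : E.map σ.toLinearMap ≤ W := (Submodule.map_mono hEW).trans hσ
  have hE₃ : (E.map σ.toLinearMap).map σ.toLinearMap ≤ W := (Submodule.map_mono hE₂).trans hσ
  have ζ_mem : ∀ {n a b c x}, x ∈ multiPow σ U E n a b c → ζ x = x := by
    intro n a b c x hx
    have := multiPow_le_eigen (hUW.trans hζ) (hEW.trans hζ) (hE₂.trans hζ) (hE₃.trans hζ) n a b c hx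
    simpa [mem_eigen] using this
  -- The sign of `α` is -1 exactly on σE and σ²E, that of `β` exactly on E and σE. Hence being fixed
  -- by both amounts to equal parities of `a`, `b`, `c`.
  have α_mem : ∀ {n a b c x}, x ∈ multiPow σ U E n a b c → x ∈ eigen α ((-1) ^ (b + c)) := by
    intro n a b c x hx
    have := multiPow_le_eigen hUα a₁ a₂ a₃ n a b c hx
    simpa [pow_add] using this
  have β_mem : ∀ {n a b c x}, x ∈ multiPow σ U E n a b c → x ∈ eigen β ((-1) ^ (a + b)) := by
    intro n a b c x hx
    have := multiPow_le_eigen hUβ b₁ b₂ b₃ n a b c hx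
    simpa [pow_add] using this
  have balanced : ∀ {d m}, IsBalanced σ U E d m →
      reynolds α β σ ζ m = (8 : F) • transfer σ m := by
    rintro d m ⟨n, a, b, c, hab, hbc, -, hm⟩
    exact reynolds_eq_smul_transfer (ζ_mem hm) ((apply_eq_or_of_mem_eigen (α_mem hm)).1 (by omega))
      ((apply_eq_or_of_mem_eigen (β_mem hm)).1 (by omega))
  have h8 : (8 : F) ≠ 0 := by
    rw [show (8 : F) = 2 ^ 3 by norm_num]
    exact pow_ne_zero 3 h2
  have small : ∀ d ≤ 6, ∀ m, IsBalanced σ U E d m → transfer σ m ∈ B := by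
    intro d hd m hm
    have hr := balanced hm
    obtain ⟨n, a, b, c, -, -, rfl, hm⟩ := hm
    have hle : multiPow σ U E n a b c ≤ W ^ (n + a + b + c) := by
      rw [pow_add, pow_add, pow_add]
      exact mul_le_mul' (mul_le_mul' (mul_le_mul' (pow_le_pow_left' hUW n)
        (pow_le_pow_left' hEW a)) (pow_le_pow_left' hE₂ b)) (pow_le_pow_left' hE₃ c)
    have := hB _ hd m (hle hm)
    rw [hr] at this
    have := B.smul_mem this (8 : F)⁻¹
    rwa [inv_smul_smul₀ h8] at this
  have main : ∀ n a b c, multiPow σ U E n a b c ≤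
      (Subalgebra.toSubmodule B).comap (reynolds α β σ ζ) := by
    intro n a b c m hm
    rw [Submodule.mem_comap, Subalgebra.mem_toSubmodule]
    by_cases hab : a % 2 = b % 2
    · by_cases hbc : b % 2 = c % 2
      · have hm' : IsBalanced σ U E (n + a + b + c) m := ⟨n, a, b, c, hab, hbc, rfl, hm⟩
        rw [balanced hm']
        exact B.smul_mem (transfer_mem_of_isBalanced h.cube hUσ h3 small _ m hm') _
      · rw [reynolds_eq_zero (Or.inr (Or.inr ⟨ζ_mem hm,
          (apply_eq_or_of_mem_eigen (β_mem hm)).1 (by omega),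
          (apply_eq_or_of_mem_eigen (α_mem hm)).2 (by omega)⟩))]
        exact B.zero_mem
    · rw [reynolds_eq_zero (Or.inr (Or.inl ⟨ζ_mem hm,
        (apply_eq_or_of_mem_eigen (β_mem hm)).2 (by omega)⟩))]
      exact B.zero_mem
  refine (pow_le_pow_left' hW k).trans ?_
  simpa [multiPow] using mul_pow_le_of_multiPow_le main k 0 0 0 0

/-- If an algebra is generated by a stable space `L`, then its invariants are generated by those of
degree at most `12` in `L`. -/
theorem IsTetrahedral.reynolds_mem (h : IsTetrahedral α β σ ζ) (h2 : (2 : F) ≠ 0)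
    (h3 : (3 : F) ≠ 0) {L : Submodule F A} (hα : L.map α.toLinearMap ≤ L)
    (hβ : L.map β.toLinearMap ≤ L) (hσ : L.map σ.toLinearMap ≤ L)
    {B : Subalgebra F A} (hB : ∀ j ≤ 12, ∀ x ∈ L ^ j, reynolds α β σ ζ x ∈ B) (k : ℕ) :
    L ^ k ≤ (Subalgebra.toSubmodule B).comap (reynolds α β σ ζ) := by
  set P := L ⊓ eigen ζ 1 with hP
  set N := L ⊓ eigen ζ (-1) with hN
  have hLPN : L ≤ P ⊔ N := by
    refine le_sup_inf_eigen h2 ?_ fun x _ => h.zeta_sq x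
    rintro _ ⟨x, hx, rfl⟩
    rw [AlgHom.toLinearMap_apply, ← h.left_sq]
    exact hα (Submodule.mem_map_of_mem (hα (Submodule.mem_map_of_mem hx)))
  have stable : ∀ φ : A →ₐ[F] A, (∀ x, ζ (φ x) = φ (ζ x)) → L.map φ.toLinearMap ≤ L →
      (P ⊔ N ^ 2).map φ.toLinearMap ≤ P ⊔ N ^ 2 := by
    intro φ hφ hL
    rw [Submodule.map_sup, Submodule.map_pow]
    exact sup_le_sup (map_inf_eigen_le hφ hL 1) (pow_le_pow_left' (map_inf_eigen_le hφ hL (-1)) 2)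
  have hζ : P ⊔ N ^ 2 ≤ eigen ζ 1 := by
    refine sup_le inf_le_right ?_
    convert (pow_le_pow_left' inf_le_right 2).trans (eigen_pow_le ζ (-1) 2) using 2
    norm_num
  have hdeg : P ⊔ N ^ 2 ≤ degreeLE L 2 := by
    refine sup_le (inf_le_left.trans ?_) ((pow_le_pow_left' inf_le_left 2).trans
      (pow_le_degreeLE L le_rfl))
    simpa using pow_le_degreeLE L (show 1 ≤ 2 by norm_num)
  have hW := h.reynolds_mem_of_mem_pow h2 h3 (stable α h.zeta_left hα) (stable β h.zeta_right hβ)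
    (stable σ h.zeta_sigma hσ) hζ (B := B) <| by
      intro j hj x hx
      -- `W` mixes degrees 1 and 2 in `L`, so `W ^ j` with j ≤ 6 is only filtered, in degree at most
      -- 12.
      have hle : degreeLE L 12 ≤ (Subalgebra.toSubmodule B).comap (reynolds α β σ ζ) :=
        iSup₂_le fun j hj x hx => hB j hj x hx
      exact hle (degreeLE_mono L (by omega) (degreeLE_pow_le L 2 j (pow_le_pow_left' hdeg j hx)))
  have main : ∀ p q, P ^ p * N ^ q ≤ (Subalgebra.toSubmodule B).comap (reynolds α β σ ζ) := by
    intro p q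
    -- An even power of `N` is a power of `N ^ 2` and lies in the algebra generated by `W`; on an
    -- odd power `ζ` is -1 and the average vanishes.
    rcases Nat.even_or_odd' q with ⟨r, rfl | rfl⟩
    · refine le_trans ?_ (hW (p + r))
      rw [pow_mul, pow_add]
      exact mul_le_mul' (pow_le_pow_left' le_sup_left p) (pow_le_pow_left' le_sup_right r)
    · intro x hx
      have hx' := ((mul_le_mul' ((pow_le_pow_left' inf_le_right p).trans (eigen_pow_le ζ 1 p))
        ((pow_le_pow_left' inf_le_right (2 * r + 1)).trans (eigen_pow_le ζ (-1) (2 * r + 1)))).trans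
          (eigen_mul_le ζ _ _)) hx
      rw [one_pow, one_mul] at hx'
      rw [Submodule.mem_comap, reynolds_eq_zero
        (Or.inl ((apply_eq_or_of_mem_eigen hx').2 (by omega)))]
      exact Submodule.zero_mem _
  refine (pow_le_pow_left' hLPN k).trans ?_
  simpa using mul_pow_le_of_pow_mul_pow_le main k 0 0

end Operators

/-! ### Arithmetic and generators of the binary tetrahedral group. -/

section BinaryTetrahedral

/-- `g = (a + b i + c j + d k) / 2`. -/
def HasCoords (g : binaryTetrahedral) (a b c d : ℤ) : Prop :=
  ((g : ℍ[ℝ]ˣ) : ℍ[ℝ]).re = a / 2 ∧ ((g : ℍ[ℝ]ˣ) : ℍ[ℝ]).imI = b / 2 ∧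
    ((g : ℍ[ℝ]ˣ) : ℍ[ℝ]).imJ = c / 2 ∧ ((g : ℍ[ℝ]ˣ) : ℍ[ℝ]).imK = d / 2

theorem exists_hasCoords (g : binaryTetrahedral) :
    ∃ a b c d : ℤ, a ^ 2 + b ^ 2 + c ^ 2 + d ^ 2 = 4 ∧ HasCoords g a b c d := g.2

theorem HasCoords.ext {g h : binaryTetrahedral} {a b c d : ℤ} (hg : HasCoords g a b c d)
    (hh : HasCoords h a b c d) : g = h := by
  apply Subtype.ext
  apply Units.ext
  ext
  · rw [hg.1, hh.1]
  · rw [hg.2.1, hh.2.1]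
  · rw [hg.2.2.1, hh.2.2.1]
  · rw [hg.2.2.2, hh.2.2.2]

theorem hasCoords_one : HasCoords 1 2 0 0 0 := by
  simp [HasCoords]

/-- Coordinates are doubled, whence the factor 2. With `HasCoords.ext`, identities in the group
become integer identities, mostly closed by `rfl`. -/
theorem HasCoords.mul {g h : binaryTetrahedral} {a b c d a' b' c' d' a'' b'' c'' d'' : ℤ}
    (hg : HasCoords g a b c d) (hh : HasCoords h a' b' c' d')
    (h₁ : 2 * a'' = a * a' - b * b' - c * c' - d * d')
    (h₂ : 2 * b'' = a * b' + b * a' + c * d' - d * c')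
    (h₃ : 2 * c'' = a * c' - b * d' + c * a' + d * b')
    (h₄ : 2 * d'' = a * d' + b * c' - c * b' + d * a') : HasCoords (g * h) a'' b'' c'' d'' := by
  obtain ⟨g₁, g₂, g₃, g₄⟩ := hg
  obtain ⟨l₁, l₂, l₃, l₄⟩ := hh
  have h₁' := congrArg (Int.cast : ℤ → ℝ) h₁
  have h₂' := congrArg (Int.cast : ℤ → ℝ) h₂
  have h₃' := congrArg (Int.cast : ℤ → ℝ) h₃
  have h₄' := congrArg (Int.cast : ℤ → ℝ) h₄
  push_cast at h₁' h₂' h₃' h₄'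
  simp only [HasCoords, Subgroup.coe_mul, Units.val_mul, Quaternion.re_mul, Quaternion.imI_mul,
    Quaternion.imJ_mul, Quaternion.imK_mul, g₁, g₂, g₃, g₄, l₁, l₂, l₃, l₄]
  refine ⟨by linarith, by linarith, by linarith, by linarith⟩

theorem exists_of_coords {a b c d : ℤ} (h : a ^ 2 + b ^ 2 + c ^ 2 + d ^ 2 = 4) :
    ∃ g : binaryTetrahedral, HasCoords g a b c d := by
  have hR : (a : ℝ) ^ 2 + b ^ 2 + c ^ 2 + d ^ 2 = 4 := by exact_mod_cast h
  let q : ℍ[ℝ] := ⟨a / 2, b / 2, c / 2, d / 2⟩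
  have hn : Quaternion.normSq q = 1 := by
    rw [Quaternion.normSq_def']
    simp only [q]
    linarith
  have h₁ : q * star q = 1 := by rw [Quaternion.self_mul_star, hn, Quaternion.coe_one]
  have h₂ : star q * q = 1 := by rw [Quaternion.star_mul_self, hn, Quaternion.coe_one]
  exact ⟨⟨⟨q, star q, h₁, h₂⟩, a, b, c, d, h, rfl, rfl, rfl, rfl⟩, rfl, rfl, rfl, rfl⟩

/-- The quaternion `i`. -/
def quatI : binaryTetrahedral := (exists_of_coords (a := 0) (b := 2) (c := 0) (d := 0) rfl).choose

theorem hasCoords_quatI : HasCoords quatI 0 2 0 0 :=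
  (exists_of_coords (a := 0) (b := 2) (c := 0) (d := 0) rfl).choose_spec

/-- The quaternion `j`. -/
def quatJ : binaryTetrahedral := (exists_of_coords (a := 0) (b := 0) (c := 2) (d := 0) rfl).choose

theorem hasCoords_quatJ : HasCoords quatJ 0 0 2 0 :=
  (exists_of_coords (a := 0) (b := 0) (c := 2) (d := 0) rfl).choose_spec

/-- The quaternion `(-1 - i - j - k) / 2` of order `3`. -/
def quatC : binaryTetrahedral :=
  (exists_of_coords (a := -1) (b := -1) (c := -1) (d := -1) rfl).choose

theorem hasCoords_quatC : HasCoords quatC (-1) (-1) (-1) (-1) :=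
  (exists_of_coords (a := -1) (b := -1) (c := -1) (d := -1) rfl).choose_spec

theorem hasCoords_quatI_sq : HasCoords (quatI * quatI) (-2) 0 0 0 :=
  hasCoords_quatI.mul hasCoords_quatI rfl rfl rfl rfl

theorem hasCoords_quatC_sq : HasCoords (quatC * quatC) (-1) 1 1 1 :=
  hasCoords_quatC.mul hasCoords_quatC rfl rfl rfl rfl

theorem quatC_cube : quatC * (quatC * quatC) = 1 :=
  (hasCoords_quatC.mul hasCoords_quatC_sq rfl rfl rfl rfl).ext hasCoords_one

theorem quatC_mul_quatI : quatC * quatI = quatJ * quatC :=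
  (hasCoords_quatC.mul hasCoords_quatI (a'' := 1) (b'' := -1) (c'' := -1) (d'' := 1)
    rfl rfl rfl rfl).ext (hasCoords_quatJ.mul hasCoords_quatC rfl rfl rfl rfl)

theorem hasCoords_quatI_mul_quatJ : HasCoords (quatI * quatJ) 0 0 0 2 :=
  hasCoords_quatI.mul hasCoords_quatJ rfl rfl rfl rfl

theorem quatC_mul_quatJ : quatC * quatJ = quatI * quatJ * quatC :=
  (hasCoords_quatC.mul hasCoords_quatJ (a'' := 1) (b'' := 1) (c'' := -1) (d'' := -1)
    rfl rfl rfl rfl).ext (hasCoords_quatI_mul_quatJ.mul hasCoords_quatC rfl rfl rfl rfl)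

theorem quatJ_mul_quatJ : quatJ * quatJ = quatI * quatI :=
  (hasCoords_quatJ.mul hasCoords_quatJ rfl rfl rfl rfl).ext hasCoords_quatI_sq

theorem quatI_sq_sq : quatI * quatI * (quatI * quatI) = 1 :=
  (hasCoords_quatI_sq.mul hasCoords_quatI_sq rfl rfl rfl rfl).ext hasCoords_one

theorem quatI_sq_mul_comm (g : binaryTetrahedral) :
    quatI * quatI * g = g * (quatI * quatI) := by
  obtain ⟨a, b, c, d, -, hg⟩ := exists_hasCoords g
  exact (hasCoords_quatI_sq.mul hg (a'' := -a) (b'' := -b) (c'' := -c) (d'' := -d) (by ring)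
    (by ring) (by ring) (by ring)).ext
    (hg.mul hasCoords_quatI_sq (by ring) (by ring) (by ring) (by ring))

theorem quatI_mul_quatJ : quatI * quatJ = quatI * quatI * (quatJ * quatI) :=
  hasCoords_quatI_mul_quatJ.ext (hasCoords_quatI_sq.mul (hasCoords_quatJ.mul hasCoords_quatI
    (a'' := 0) (b'' := 0) (c'' := 0) (d'' := -2) rfl rfl rfl rfl) rfl rfl rfl rfl)

theorem cases_of_sum_sq_eq_four {a b c d : ℤ} (h : a ^ 2 + b ^ 2 + c ^ 2 + d ^ 2 = 4) :
    (((a = 2 ∨ a = -2) ∧ b = 0 ∧ c = 0 ∧ d = 0) ∨ (a = 0 ∧ (b = 2 ∨ b = -2) ∧ c = 0 ∧ d = 0) ∨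
      (a = 0 ∧ b = 0 ∧ (c = 2 ∨ c = -2) ∧ d = 0) ∨ (a = 0 ∧ b = 0 ∧ c = 0 ∧ (d = 2 ∨ d = -2))) ∨
    ((a = 1 ∨ a = -1) ∧ (b = 1 ∨ b = -1) ∧ (c = 1 ∨ c = -1) ∧ (d = 1 ∨ d = -1)) := by
  have bound : ∀ {x y z w : ℤ}, x ^ 2 + y ^ 2 + z ^ 2 + w ^ 2 = 4 → -2 ≤ x ∧ x ≤ 2 :=
    fun _ => ⟨by nlinarith, by nlinarith⟩
  obtain ⟨ha₁, ha₂⟩ := bound h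
  obtain ⟨hb₁, hb₂⟩ := bound (show b ^ 2 + a ^ 2 + c ^ 2 + d ^ 2 = 4 by linarith)
  obtain ⟨hc₁, hc₂⟩ := bound (show c ^ 2 + a ^ 2 + b ^ 2 + d ^ 2 = 4 by linarith)
  obtain ⟨hd₁, hd₂⟩ := bound (show d ^ 2 + a ^ 2 + b ^ 2 + c ^ 2 = 4 by linarith)
  obtain ⟨m, n, p, rfl, rfl, rfl⟩ := same_parity h
  have e : (a = -2 ∨ a = 0 ∨ a = 2) ∨ (a = -1 ∨ a = 1) := by omega
  rcases e with e | e
  · have hm : a + 2 * m = -2 ∨ a + 2 * m = 0 ∨ a + 2 * m = 2 := by omega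
    have hn : a + 2 * n = -2 ∨ a + 2 * n = 0 ∨ a + 2 * n = 2 := by omega
    have hp : a + 2 * p = -2 ∨ a + 2 * p = 0 ∨ a + 2 * p = 2 := by omega
    generalize a + 2 * m = b at *
    generalize a + 2 * n = c at *
    generalize a + 2 * p = d at *
    rcases e with rfl | rfl | rfl <;> rcases hm with rfl | rfl | rfl <;>
      rcases hn with rfl | rfl | rfl <;> rcases hp with rfl | rfl | rfl <;>
      first
      | exact absurd h (by decide)
      | decide
  · exact Or.inr ⟨by omega, by omega, by omega, by omega⟩

/-- The binary tetrahedral group is generated by `i` and `(-1 - i - j - k) / 2`. -/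
theorem binaryTetrahedral_induction {p : binaryTetrahedral → Prop} (hi : p quatI) (hc : p quatC)
    (hmul : ∀ g h, p g → p h → p (g * h)) (g : binaryTetrahedral) : p g := by
  have hz := hmul _ _ hi hi
  have h1 : p 1 := quatI_sq_sq ▸ hmul _ _ hz hz
  have hj : p quatJ := by
    have : quatJ = quatC * quatI * (quatC * quatC) := by
      rw [quatC_mul_quatI, mul_assoc, quatC_cube, mul_one]
    rw [this]
    exact hmul _ _ (hmul _ _ hc hi) (hmul _ _ hc hc)
  have hk := hmul _ _ hi hj
  have hc' := hmul _ _ hc hc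
  -- As -1 = i² is available, one representative of each pair ±g is enough: the twelve below are c^m
  -- times 1, i, j, k.
  have of_coords : ∀ {h : binaryTetrahedral} {a b c d : ℤ}, p h → HasCoords h a b c d →
      ∀ g, HasCoords g a b c d ∨ HasCoords g (-a) (-b) (-c) (-d) → p g := by
    rintro h a b c d hp hh g (hg | hg)
    · rwa [hg.ext hh]
    · rw [hg.ext (hasCoords_quatI_sq.mul hh (by ring) (by ring) (by ring) (by ring))]
      exact hmul _ _ hz hp
  have o1 := of_coords h1 hasCoords_one
  have oi := of_coords hi hasCoords_quatI
  have oj := of_coords hj hasCoords_quatJ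
  have ok := of_coords hk hasCoords_quatI_mul_quatJ
  have oc := of_coords hc hasCoords_quatC
  have oc' := of_coords hc' hasCoords_quatC_sq
  have oci := of_coords (hmul _ _ hc hi) (hasCoords_quatC.mul hasCoords_quatI (a'' := 1)
    (b'' := -1) (c'' := -1) (d'' := 1) rfl rfl rfl rfl)
  have ocj := of_coords (hmul _ _ hc hj) (hasCoords_quatC.mul hasCoords_quatJ (a'' := 1)
    (b'' := 1) (c'' := -1) (d'' := -1) rfl rfl rfl rfl)
  have ock := of_coords (hmul _ _ hc hk) (hasCoords_quatC.mul hasCoords_quatI_mul_quatJ (a'' := 1)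
    (b'' := -1) (c'' := 1) (d'' := -1) rfl rfl rfl rfl)
  have oci' := of_coords (hmul _ _ hc' hi) (hasCoords_quatC_sq.mul hasCoords_quatI (a'' := -1)
    (b'' := -1) (c'' := 1) (d'' := -1) rfl rfl rfl rfl)
  have ocj' := of_coords (hmul _ _ hc' hj) (hasCoords_quatC_sq.mul hasCoords_quatJ (a'' := -1)
    (b'' := -1) (c'' := -1) (d'' := 1) rfl rfl rfl rfl)
  have ock' := of_coords (hmul _ _ hc' hk) (hasCoords_quatC_sq.mul hasCoords_quatI_mul_quatJ
    (a'' := -1) (b'' := 1) (c'' := -1) (d'' := -1) rfl rfl rfl rfl)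
  obtain ⟨a, b, c, d, hn, hg⟩ := exists_hasCoords g
  rcases cases_of_sum_sq_eq_four hn with (⟨rfl | rfl, rfl, rfl, rfl⟩ | ⟨rfl, rfl | rfl, rfl, rfl⟩ |
    ⟨rfl, rfl, rfl | rfl, rfl⟩ | ⟨rfl, rfl, rfl, rfl | rfl⟩) |
    ⟨rfl | rfl, rfl | rfl, rfl | rfl, rfl | rfl⟩
  · exact o1 g (Or.inl hg)
  · exact o1 g (Or.inr hg)
  · exact oi g (Or.inl hg)
  · exact oi g (Or.inr hg)
  · exact oj g (Or.inl hg)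
  · exact oj g (Or.inr hg)
  · exact ok g (Or.inl hg)
  · exact ok g (Or.inr hg)
  · exact oc g (Or.inr hg)
  · exact ocj' g (Or.inr hg)
  · exact oci' g (Or.inr hg)
  · exact ocj g (Or.inl hg)
  · exact ock' g (Or.inr hg)
  · exact ock g (Or.inl hg)
  · exact oci g (Or.inl hg)
  · exact oc' g (Or.inr hg)
  · exact oc' g (Or.inl hg)
  · exact oci g (Or.inr hg)
  · exact ock g (Or.inr hg)
  · exact ock' g (Or.inl hg)
  · exact ocj g (Or.inr hg)
  · exact oci' g (Or.inl hg)
  · exact ocj' g (Or.inl hg)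
  · exact oc g (Or.inl hg)

end BinaryTetrahedral

/-! ### The action on the coordinate ring. -/

section Action

variable {F : Type u} {G : Type v} {V : Type u} [Field F] [Group G] [AddCommGroup V] [Module F V]

theorem act_ι (ρ : Representation F G V) (g : G) (x : Module.Dual F V) :
    act ρ g (SymmetricAlgebra.ι F _ x) = SymmetricAlgebra.ι F _ (x ∘ₗ ρ g) := by
  rw [act, SymmetricAlgebra.lift_ι_apply]
  rfl

/-- Substitution is a right action, so `g` acts first in g * h. This fixes the order of the
operators in `IsTetrahedral`. -/
theorem act_act (ρ : Representation F G V) (g h : G) (f : CoordRing F V) :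
    act ρ h (act ρ g f) = act ρ (g * h) f := by
  have : (act ρ h).comp (act ρ g) = act ρ (g * h) := by
    apply SymmetricAlgebra.algHom_ext
    refine LinearMap.ext fun x => ?_
    change act ρ h (act ρ g (SymmetricAlgebra.ι F _ x)) = act ρ (g * h) (SymmetricAlgebra.ι F _ x)
    rw [act_ι, act_ι, act_ι, map_mul]
    rfl
  exact DFunLike.congr_fun this f

theorem act_one (ρ : Representation F G V) (f : CoordRing F V) : act ρ 1 f = f := by
  have : act ρ 1 = AlgHom.id F _ := by
    apply SymmetricAlgebra.algHom_ext
    refine LinearMap.ext fun x => ?_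
    change act ρ 1 (SymmetricAlgebra.ι F _ x) = SymmetricAlgebra.ι F _ x
    rw [act_ι, map_one]
    rfl
  exact DFunLike.congr_fun this f

theorem map_act_range_ι_le (ρ : Representation F G V) (g : G) :
    (LinearMap.range (SymmetricAlgebra.ι F (Module.Dual F V))).map (act ρ g).toLinearMap ≤
      LinearMap.range (SymmetricAlgebra.ι F (Module.Dual F V)) := by
  rintro _ ⟨_, ⟨x, rfl⟩, rfl⟩
  exact ⟨x ∘ₗ ρ g, (act_ι ρ g x).symm⟩

theorem map_act_homogeneousPart_le (ρ : Representation F G V) (g : G) (d : ℕ) :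
    (homogeneousPart F V d).map (act ρ g).toLinearMap ≤ homogeneousPart F V d := by
  rw [homogeneousPart, Submodule.map_pow]
  exact pow_le_pow_left' (map_act_range_ι_le ρ g) d

theorem iSup_homogeneousPart : ⨆ d, homogeneousPart F V d = ⊤ := by
  rw [eq_top_iff]
  rintro f -
  induction f using SymmetricAlgebra.induction with
  | algebraMap r =>
    refine Submodule.mem_iSup_of_mem 0 ?_
    rw [homogeneousPart, pow_zero]
    exact Submodule.algebraMap_mem r
  | ι x =>
    refine Submodule.mem_iSup_of_mem 1 ?_
    rw [homogeneousPart, pow_one]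
    exact ⟨x, rfl⟩
  | mul a b ha hb =>
    have : (⨆ d, homogeneousPart F V d) * (⨆ d, homogeneousPart F V d) ≤
        ⨆ d, homogeneousPart F V d := by
      simp only [Submodule.iSup_mul, Submodule.mul_iSup, iSup_le_iff]
      intro i j
      rw [homogeneousPart, homogeneousPart, ← pow_add]
      exact le_iSup (homogeneousPart F V) _
    exact this (Submodule.mul_mem_mul ha hb)
  | add a b ha hb => exact Submodule.add_mem _ ha hb

end Action

/-! ### The bound 12 from above. -/

section UpperBound

variable {F : Type u} {V : Type u} [Field F] [AddCommGroup V] [Module F V]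

theorem mem_invariants_iff (ρ : Representation F binaryTetrahedral V) (f : CoordRing F V) :
    f ∈ invariants ρ ↔ act ρ quatI f = f ∧ act ρ quatC f = f := by
  refine ⟨fun h => ⟨h _, h _⟩, fun h g => ?_⟩
  refine binaryTetrahedral_induction (p := fun g => act ρ g f = f) h.1 h.2 ?_ g
  intro g h hg hh
  rw [← act_act, hg, hh]

theorem isTetrahedral_act (ρ : Representation F binaryTetrahedral V) :
    IsTetrahedral (act ρ quatI) (act ρ quatJ) (act ρ quatC) (act ρ (quatI * quatI)) where
  cube x := by simp only [act_act, mul_assoc, quatC_cube, act_one]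
  apply_left_sigma x := by simp only [act_act, quatC_mul_quatI]
  apply_right_sigma x := by simp only [act_act, quatC_mul_quatJ]
  left_sq x := by simp only [act_act]
  right_sq x := by simp only [act_act, quatJ_mul_quatJ]
  swap x := by rw [act_act, act_act, act_act, quatI_mul_quatJ, mul_assoc]
  zeta_left x := by simp only [act_act, quatI_sq_mul_comm]
  zeta_right x := by simp only [act_act, quatI_sq_mul_comm]
  zeta_sigma x := by simp only [act_act, quatI_sq_mul_comm]
  zeta_sq x := by simp only [act_act, quatI_sq_sq, act_one]

theorem generatedInDegreeLE_twelve (h2 : (2 : F) ≠ 0) (h3 : (3 : F) ≠ 0)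
    (ρ : Representation F binaryTetrahedral V) : GeneratedInDegreeLE ρ 12 := by
  apply le_antisymm
  · exact Algebra.adjoin_le fun f hf => hf.1
  · intro f hf
    have h := isTetrahedral_act ρ
    have hmem := h.reynolds_mem h2 h3 (map_act_range_ι_le ρ _) (map_act_range_ι_le ρ _)
      (map_act_range_ι_le ρ _) (B := Algebra.adjoin F
        {f : CoordRing F V | f ∈ invariants ρ ∧ ∃ i ≤ 12, f ∈ homogeneousPart F V i}) <| by
      intro j hj x hx
      refine Algebra.subset_adjoin ⟨(mem_invariants_iff ρ _).2 (h.reynolds_fixed x), j, hj, ?_⟩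
      exact h.map_reynolds_le (map_act_homogeneousPart_le ρ _ j) (map_act_homogeneousPart_le ρ _ j)
        (map_act_homogeneousPart_le ρ _ j) hx
    have htop := iSup_le hmem
    have hf' := htop (show f ∈ ⨆ d, homogeneousPart F V d by rw [iSup_homogeneousPart]; trivial)
    rw [Submodule.mem_comap, h.reynolds_of_fixed (hf _) (hf _)] at hf'
    have h24 : (24 : F) ≠ 0 := by
      rw [show (24 : F) = 2 ^ 3 * 3 by norm_num]
      exact mul_ne_zero (pow_ne_zero 3 h2) h3
    have := Submodule.smul_mem _ (24 : F)⁻¹ hf'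
    rwa [inv_smul_smul₀ h24] at this

theorem beta_binaryTetrahedral_le (h2 : (2 : F) ≠ 0) (h3 : (3 : F) ≠ 0) :
    beta F binaryTetrahedral ≤ 12 := by
  simp only [beta, iSup_le_iff]
  intro V _ _ _ ρ
  exact iInf₂_le (12 : ℕ) (generatedInDegreeLE_twelve h2 h3 ρ)

end UpperBound

/-! ### Values of polynomial functions and of invariants. -/

section Evaluation

variable {F : Type u} {G : Type v} {V : Type u} [Field F] [Group G] [AddCommGroup V] [Module F V]

/-- The evaluation of polynomial functions at a vector. -/
def evalAt (v : V) : CoordRing F V →ₐ[F] F := SymmetricAlgebra.lift (Module.Dual.eval F V v)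

theorem evalAt_ι (v : V) (x : Module.Dual F V) : evalAt v (SymmetricAlgebra.ι F _ x) = x v := by
  rw [evalAt, SymmetricAlgebra.lift_ι_apply]
  rfl

theorem evalAt_act (ρ : Representation F G V) (g : G) (v : V) (f : CoordRing F V) :
    evalAt v (act ρ g f) = evalAt (ρ g v) f := by
  have : (evalAt v).comp (act ρ g) = evalAt (ρ g v) := by
    apply SymmetricAlgebra.algHom_ext
    refine LinearMap.ext fun x => ?_
    change evalAt v (act ρ g (SymmetricAlgebra.ι F _ x)) =
      evalAt (ρ g v) (SymmetricAlgebra.ι F _ x)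
    rw [act_ι, evalAt_ι, evalAt_ι]
    rfl
  exact DFunLike.congr_fun this f

theorem evalAt_of_mem_invariants {ρ : Representation F G V} {f : CoordRing F V}
    (hf : f ∈ invariants ρ) (g : G) (v : V) : evalAt (ρ g v) f = evalAt v f := by
  rw [← evalAt_act, hf g]

theorem evalAt_smul {d : ℕ} {f : CoordRing F V} (hf : f ∈ homogeneousPart F V d) (r : F) (v : V) :
    evalAt (r • v) f = r ^ d * evalAt v f := by
  induction hf using Submodule.pow_induction_on_left' with
  | algebraMap c => simp
  | add x y i _ _ hx hy => rw [map_add, map_add, hx, hy, mul_add]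
  | mem_mul m hm i x _ hx =>
    obtain ⟨l, rfl⟩ := hm
    rw [map_mul, map_mul, hx, evalAt_ι, evalAt_ι, map_smul, smul_eq_mul, pow_succ]
    ring

theorem exists_coeff_evalAt {d : ℕ} {f : CoordRing F (Fin 2 → F)}
    (hf : f ∈ homogeneousPart F (Fin 2 → F) d) : ∃ c : ℕ → F, ∀ a b : F,
      evalAt ![a, b] f = ∑ k ∈ Finset.range (d + 1), c k * a ^ k * b ^ (d - k) := by
  induction hf using Submodule.pow_induction_on_left' with
  | algebraMap r => exact ⟨fun _ => r, fun a b => by simp⟩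
  | add x y i _ _ hx hy =>
    obtain ⟨c, hc⟩ := hx
    obtain ⟨c', hc'⟩ := hy
    refine ⟨c + c', fun a b => ?_⟩
    rw [map_add, hc, hc', ← Finset.sum_add_distrib]
    refine Finset.sum_congr rfl fun k _ => ?_
    rw [Pi.add_apply]
    ring
  | mem_mul m hm i x _ hx =>
    obtain ⟨l, rfl⟩ := hm
    obtain ⟨c, hc⟩ := hx
    -- Multiplying by the first coordinate shifts the coefficients and by the second does not; the
    -- conditionals put 0 at the missing end.
    refine ⟨fun k => l ![1, 0] * (if k = 0 then 0 else c (k - 1)) +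
      l ![0, 1] * (if k = i + 1 then 0 else c k), fun a b => ?_⟩
    have hl : l ![a, b] = a * l ![1, 0] + b * l ![0, 1] := by
      rw [← smul_eq_mul, ← smul_eq_mul, ← map_smul, ← map_smul, ← map_add]
      simp
    have h₁ : ∑ k ∈ Finset.range (i + 1 + 1), (l ![1, 0] * (if k = 0 then 0 else c (k - 1))) *
        a ^ k * b ^ (i + 1 - k) = a * l ![1, 0] *
          ∑ k ∈ Finset.range (i + 1), c k * a ^ k * b ^ (i - k) := by
      rw [Finset.sum_range_succ', Finset.mul_sum]
      simp only [if_true, mul_zero, zero_mul, add_zero]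
      refine Finset.sum_congr rfl fun k _ => ?_
      rw [if_neg (Nat.succ_ne_zero k), Nat.add_sub_cancel, Nat.add_sub_add_right]
      ring
    have h₂ : ∑ k ∈ Finset.range (i + 1 + 1), (l ![0, 1] * (if k = i + 1 then 0 else c k)) *
        a ^ k * b ^ (i + 1 - k) = b * l ![0, 1] *
          ∑ k ∈ Finset.range (i + 1), c k * a ^ k * b ^ (i - k) := by
      rw [Finset.sum_range_succ, Finset.mul_sum]
      simp only [if_true, mul_zero, zero_mul, add_zero]
      refine Finset.sum_congr rfl fun k hk => ?_
      have hk := Finset.mem_range.1 hk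
      rw [if_neg (by omega), Nat.succ_sub (by omega), pow_succ]
      ring
    rw [map_mul, evalAt_ι, hc, hl, add_mul, ← h₁, ← h₂, ← Finset.sum_add_distrib]
    refine Finset.sum_congr rfl fun k _ => ?_
    ring

end Evaluation

/-! ### A two-dimensional representation over F. -/

section PlaneRepresentation

variable {F : Type u} [Field F]

/-- The doubled coordinates are integers, so `floor` recovers them from the real quaternion and they
can be cast to F. This is what makes `toQuaternion` definable without choices. -/
theorem HasCoords.floor {g : binaryTetrahedral} {a b c d : ℤ} (h : HasCoords g a b c d) :
    ⌊2 * ((g : ℍ[ℝ]ˣ) : ℍ[ℝ]).re⌋ = a ∧ ⌊2 * ((g : ℍ[ℝ]ˣ) : ℍ[ℝ]).imI⌋ = b ∧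
      ⌊2 * ((g : ℍ[ℝ]ˣ) : ℍ[ℝ]).imJ⌋ = c ∧ ⌊2 * ((g : ℍ[ℝ]ˣ) : ℍ[ℝ]).imK⌋ = d := by
  obtain ⟨h₁, h₂, h₃, h₄⟩ := h
  have e : ∀ x : ℤ, ⌊(2 : ℝ) * (x / 2)⌋ = x := fun x => by
    rw [mul_div_cancel₀ _ (two_ne_zero' ℝ), Int.floor_intCast]
  rw [h₁, h₂, h₃, h₄]
  exact ⟨e a, e b, e c, e d⟩

theorem HasCoords.mul_relations {g h : binaryTetrahedral} {a b c d a' b' c' d' a'' b'' c'' d'' : ℤ}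
    (hg : HasCoords g a b c d) (hh : HasCoords h a' b' c' d')
    (hgh : HasCoords (g * h) a'' b'' c'' d'') :
    2 * a'' = a * a' - b * b' - c * c' - d * d' ∧ 2 * b'' = a * b' + b * a' + c * d' - d * c' ∧
    2 * c'' = a * c' - b * d' + c * a' + d * b' ∧ 2 * d'' = a * d' + b * c' - c * b' + d * a' := by
  obtain ⟨g₁, g₂, g₃, g₄⟩ := hg
  obtain ⟨l₁, l₂, l₃, l₄⟩ := hh
  obtain ⟨k₁, k₂, k₃, k₄⟩ := hgh
  simp only [Subgroup.coe_mul, Units.val_mul, Quaternion.re_mul, Quaternion.imI_mul,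
    Quaternion.imJ_mul, Quaternion.imK_mul, g₁, g₂, g₃, g₄, l₁, l₂, l₃, l₄] at k₁ k₂ k₃ k₄
  have e₁ : (2 : ℝ) * a'' = a * a' - b * b' - c * c' - d * d' := by linarith
  have e₂ : (2 : ℝ) * b'' = a * b' + b * a' + c * d' - d * c' := by linarith
  have e₃ : (2 : ℝ) * c'' = a * c' - b * d' + c * a' + d * b' := by linarith
  have e₄ : (2 : ℝ) * d'' = a * d' + b * c' - c * b' + d * a' := by linarith
  exact ⟨by exact_mod_cast e₁, by exact_mod_cast e₂, by exact_mod_cast e₃, by exact_mod_cast e₄⟩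

/-- The reduction of the binary tetrahedral group to the quaternions over a field. -/
def toQuaternion (h2 : (2 : F) ≠ 0) : binaryTetrahedral →* ℍ[F,-1,0,-1] where
  toFun g := ⟨(⌊2 * ((g : ℍ[ℝ]ˣ) : ℍ[ℝ]).re⌋ : F) / 2, (⌊2 * ((g : ℍ[ℝ]ˣ) : ℍ[ℝ]).imI⌋ : F) / 2,
    (⌊2 * ((g : ℍ[ℝ]ˣ) : ℍ[ℝ]).imJ⌋ : F) / 2, (⌊2 * ((g : ℍ[ℝ]ˣ) : ℍ[ℝ]).imK⌋ : F) / 2⟩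
  map_one' := by
    ext <;> simp [h2]
  map_mul' g h := by
    obtain ⟨a, b, c, d, -, hg⟩ := exists_hasCoords g
    obtain ⟨a', b', c', d', -, hh⟩ := exists_hasCoords h
    obtain ⟨a'', b'', c'', d'', -, hgh⟩ := exists_hasCoords (g * h)
    obtain ⟨e₁, e₂, e₃, e₄⟩ := hg.mul_relations hh hgh
    obtain ⟨g₁, g₂, g₃, g₄⟩ := hg.floor
    obtain ⟨l₁, l₂, l₃, l₄⟩ := hh.floor
    obtain ⟨k₁, k₂, k₃, k₄⟩ := hgh.floor
    rw [g₁, g₂, g₃, g₄, l₁, l₂, l₃, l₄, k₁, k₂, k₃, k₄]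
    have e₁' := congrArg (Int.cast : ℤ → F) e₁
    have e₂' := congrArg (Int.cast : ℤ → F) e₂
    have e₃' := congrArg (Int.cast : ℤ → F) e₃
    have e₄' := congrArg (Int.cast : ℤ → F) e₄
    push_cast at e₁' e₂' e₃' e₄'
    ext
    · rw [QuaternionAlgebra.re_mul]
      field_simp
      linear_combination e₁'
    · rw [QuaternionAlgebra.imI_mul]
      field_simp
      linear_combination e₂'
    · rw [QuaternionAlgebra.imJ_mul]
      field_simp
      linear_combination e₃'
    · rw [QuaternionAlgebra.imK_mul]
      field_simp
      linear_combination e₄'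

theorem toQuaternion_apply (h2 : (2 : F) ≠ 0) {g : binaryTetrahedral} {a b c d : ℤ}
    (h : HasCoords g a b c d) : toQuaternion h2 g = ⟨(a : F) / 2, b / 2, c / 2, d / 2⟩ := by
  obtain ⟨h₁, h₂, h₃, h₄⟩ := h.floor
  have e : toQuaternion h2 g = ⟨(⌊2 * ((g : ℍ[ℝ]ˣ) : ℍ[ℝ]).re⌋ : F) / 2,
    (⌊2 * ((g : ℍ[ℝ]ˣ) : ℍ[ℝ]).imI⌋ : F) / 2, (⌊2 * ((g : ℍ[ℝ]ˣ) : ℍ[ℝ]).imJ⌋ : F) / 2,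
    (⌊2 * ((g : ℍ[ℝ]ˣ) : ℍ[ℝ]).imK⌋ : F) / 2⟩ := rfl
  rw [e, h₁, h₂, h₃, h₄]

variable {ω t : F}

/-- Matrices satisfying the relations of the quaternions, for a primitive third root of unity `ω`
and `t = (2 ω + 1) / 3`. -/
def planeBasis (hω : ω ^ 2 + ω + 1 = 0) (ht : 3 * t = 2 * ω + 1) (ht' : 3 * t ^ 2 = -1) :
    QuaternionAlgebra.Basis (Matrix (Fin 2) (Fin 2) F) (-1 : F) 0 (-1) where
  -- The basis diagonalizes `quatC` as diag(ω², ω). The matrix `i` has trace 0 and determinant -3t²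
  -- = 1, and `j`, `k` are its conjugates under that diagonal matrix.
  i := !![t, 2 * t; t, -t]
  j := !![t, 2 * ω * t; ω ^ 2 * t, -t]
  k := !![t, 2 * ω ^ 2 * t; ω * t, -t]
  i_mul_i := by
    ext i j
    fin_cases i <;> fin_cases j <;> simp <;> grind
  j_mul_j := by
    ext i j
    fin_cases i <;> fin_cases j <;> simp <;> grind
  i_mul_j := by
    ext i j
    fin_cases i <;> fin_cases j <;> simp <;> grind
  j_mul_i := by
    ext i j
    fin_cases i <;> fin_cases j <;> simp <;> grind

/-- A two-dimensional faithful representation of the binary tetrahedral group. -/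
def planeRep (h2 : (2 : F) ≠ 0) (hω : ω ^ 2 + ω + 1 = 0) (ht : 3 * t = 2 * ω + 1)
    (ht' : 3 * t ^ 2 = -1) : Representation F binaryTetrahedral (Fin 2 → F) :=
  ((Matrix.toLinAlgEquiv' (R := F) (n := Fin 2) : Matrix (Fin 2) (Fin 2) F →* _).comp
    ((planeBasis hω ht ht').liftHom : ℍ[F,-1,0,-1] →* Matrix (Fin 2) (Fin 2) F)).comp
        (toQuaternion h2)

variable (h2 : (2 : F) ≠ 0) (hω : ω ^ 2 + ω + 1 = 0) (ht : 3 * t = 2 * ω + 1)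
  (ht' : 3 * t ^ 2 = -1)

theorem planeRep_quatI (a b : F) :
    planeRep h2 hω ht ht' quatI ![a, b] = ![t * (a + 2 * b), t * (a - b)] := by
  change Matrix.toLinAlgEquiv' ((planeBasis hω ht ht').lift (toQuaternion h2 quatI)) ![a, b] = _
  rw [toQuaternion_apply h2 hasCoords_quatI]
  ext i
  fin_cases i <;> simp [QuaternionAlgebra.Basis.lift, planeBasis, h2] <;> ring

theorem planeRep_quatC (a b : F) :
    planeRep h2 hω ht ht' quatC ![a, b] = ![ω ^ 2 * a, ω * b] := by
  have hM : (planeBasis hω ht ht').lift (toQuaternion h2 quatC) = !![ω ^ 2, 0; 0, ω] := by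
    rw [toQuaternion_apply h2 hasCoords_quatC]
    ext i j
    fin_cases i <;> fin_cases j <;>
      simp [QuaternionAlgebra.Basis.lift, planeBasis, Matrix.algebraMap_matrix_apply] <;>
      field_simp <;> grind
  change Matrix.toLinAlgEquiv' ((planeBasis hω ht ht').lift (toQuaternion h2 quatC)) ![a, b] = _
  rw [hM]
  ext i
  fin_cases i <;> simp [mul_comm]

end PlaneRepresentation

/-! ### The bound 12 from below. -/

section LowerBound

variable {F : Type u} [Field F] {ω t : F} (h2 : (2 : F) ≠ 0) (hω : ω ^ 2 + ω + 1 = 0)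
  (ht : 3 * t = 2 * ω + 1) (ht' : 3 * t ^ 2 = -1)

/-- The linear form `v ↦ v i` on the plane. -/
def planeCoord (i : Fin 2) : CoordRing F (Fin 2 → F) := SymmetricAlgebra.ι F _ (LinearMap.proj i)

theorem act_quatI_planeCoord :
    act (planeRep h2 hω ht ht') quatI (planeCoord 0) = t • (planeCoord 0 + 2 * planeCoord 1) ∧
    act (planeRep h2 hω ht ht') quatI (planeCoord 1) = t • (planeCoord 0 - planeCoord 1) := by
  have e : (2 : CoordRing F (Fin 2 → F)) * planeCoord 1 = (2 : F) • planeCoord 1 := by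
    rw [Algebra.smul_def, map_ofNat]
  rw [e]
  simp only [planeCoord, act_ι, ← map_add, ← map_sub, ← map_smul]
  constructor <;>
  · congr 1
    refine LinearMap.ext fun v => ?_
    have hv : v = ![v 0, v 1] := by ext i; fin_cases i <;> rfl
    rw [hv, LinearMap.comp_apply, planeRep_quatI]
    simp [mul_add]

theorem act_quatC_planeCoord :
    act (planeRep h2 hω ht ht') quatC (planeCoord 0) = ω ^ 2 • planeCoord 0 ∧
    act (planeRep h2 hω ht ht') quatC (planeCoord 1) = ω • planeCoord 1 := by
  simp only [planeCoord, act_ι, ← map_smul]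
  constructor <;>
  · congr 1
    refine LinearMap.ext fun v => ?_
    have hv : v = ![v 0, v 1] := by ext i; fin_cases i <;> rfl
    rw [hv, LinearMap.comp_apply, planeRep_quatC]
    simp

variable (F) in
/-- The quartic form `y (x³ - y³)`, whose zeros are the vertices of a tetrahedron. -/
def quartic : CoordRing F (Fin 2 → F) := planeCoord 1 * (planeCoord 0 ^ 3 - planeCoord 1 ^ 3)

include ht' in
theorem act_quatI_quartic :
    act (planeRep h2 hω ht ht') quatI (quartic F) = quartic F := by
  obtain ⟨e₀, e₁⟩ := act_quatI_planeCoord h2 hω ht ht'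
  have h : 9 * t ^ 4 = 1 := by linear_combination (3 * t ^ 2 - 1) * ht'
  have h' := congrArg (algebraMap F (CoordRing F (Fin 2 → F))) h
  simp only [map_mul, map_pow, map_ofNat, map_one] at h'
  simp only [quartic, map_mul, map_sub, map_pow, e₀, e₁, Algebra.smul_def]
  linear_combination planeCoord 1 * (planeCoord 0 ^ 3 - planeCoord 1 ^ 3) * h'

theorem act_quatC_quartic :
    act (planeRep h2 hω ht ht') quatC (quartic F) = ω • quartic F := by
  obtain ⟨e₀, e₁⟩ := act_quatC_planeCoord h2 hω ht ht'
  have h : ω ^ 3 = 1 := by linear_combination (ω - 1) * hω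
  have h' := congrArg (algebraMap F (CoordRing F (Fin 2 → F))) h
  simp only [map_pow, map_one] at h'
  simp only [quartic, map_mul, map_sub, map_pow, e₀, e₁, Algebra.smul_def]
  generalize algebraMap F (CoordRing F (Fin 2 → F)) ω = w at *
  have h6 : w ^ 6 = 1 := by linear_combination (w ^ 3 + 1) * h'
  linear_combination w * planeCoord 1 * (planeCoord 0 ^ 3 * h6 - planeCoord 1 ^ 3 * h')

/-- The quartic is fixed by `quatI` and multiplied by the cube root of unity `ω` under `quatC`, so
its cube is invariant. -/
theorem quartic_cube_mem_invariants :
    quartic F ^ 3 ∈ invariants (planeRep h2 hω ht ht') := by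
  rw [mem_invariants_iff, map_pow, map_pow, act_quatI_quartic h2 hω ht ht', act_quatC_quartic,
    smul_pow]
  have h : ω ^ 3 = 1 := by linear_combination (ω - 1) * hω
  rw [h, one_smul]
  exact ⟨rfl, rfl⟩

theorem evalAt_quartic (a b : F) : evalAt ![a, b] (quartic F) = b * (a ^ 3 - b ^ 3) := by
  simp [quartic, planeCoord, evalAt_ι]

include hω in
-- For such `d` the element 1 - ω^d divides 3, since (1 - ω)(1 - ω²) = 3.
theorem eq_zero_of_eq_pow_mul {x : F} (h3 : (3 : F) ≠ 0) {d : ℕ} (hd : ¬ 3 ∣ d)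
    (h : x = ω ^ d * x) : x = 0 := by
  have hω3 : ω ^ 3 = 1 := by linear_combination (ω - 1) * hω
  rw [pow_eq_pow_mod d hω3] at h
  have : d % 3 = 1 ∨ d % 3 = 2 := by omega
  have h3x : 3 * x = 0 := by
    rcases this with e | e <;> rw [e] at h
    · linear_combination (2 + ω) * h + x * hω
    · linear_combination (1 - ω) * h + x * (2 - ω) * hω
  exact (mul_eq_zero.1 h3x).resolve_left h3

include h2 hω ht' in
-- Invariance under `quatC` leaves only the terms y⁶, x³y³, x⁶, and invariance under `quatI` forces
-- c₀ = -8c₆. The value of μ is chosen so that 8μ⁶ = -1, which makes c₀μ⁶ = c₆.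
theorem evalAt_eq_of_degree_six (h3 : (3 : F) ≠ 0) {μ : F} (hμ : 2 * μ ^ 2 = -1)
    {f : CoordRing F (Fin 2 → F)} (hf : f ∈ invariants (planeRep h2 hω ht ht'))
    (hd : f ∈ homogeneousPart F (Fin 2 → F) 6) : evalAt ![1, 0] f = evalAt ![0, μ] f := by
  obtain ⟨c, hc⟩ := exists_coeff_evalAt hd
  have rot : ∀ x y, evalAt ![ω ^ 2 * x, ω * y] f = evalAt ![x, y] f := fun x y => by
    rw [← planeRep_quatC h2 hω ht ht', evalAt_of_mem_invariants hf]
  have hω3 : ω ^ 3 = 1 := by linear_combination (ω - 1) * hω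
  have cubes : ∀ x y, evalAt ![x, y] f = c 0 * y ^ 6 + c 3 * x ^ 3 * y ^ 3 + c 6 * x ^ 6 := by
    intro x y
    have h₁ := rot x y
    have h₂ := rot (ω ^ 2 * x) (ω * y)
    have p₁ : evalAt ![ω ^ 2 * x, ω * y] f = c 0 * ω ^ 6 * (x ^ 0 * y ^ 6) + c 1 * ω ^ 7 * (x ^ 1
        * y ^ 5) + c 2 * ω ^ 8 * (x ^ 2 * y ^ 4) + c 3 * ω ^ 9 * (x ^ 3 * y ^ 3) + c 4 * ω ^ 10 *
        (x ^ 4 * y ^ 2) + c 5 * ω ^ 11 * (x ^ 5 * y ^ 1) + c 6 * ω ^ 12 * (x ^ 6 * y ^ 0) := by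
      rw [hc]
      simp only [Finset.sum_range_succ, Finset.sum_range_zero]
      ring
    have p₂ : evalAt ![ω ^ 2 * (ω ^ 2 * x), ω * (ω * y)] f = c 0 * ω ^ 12 * (x ^ 0 * y ^ 6) + c 1
        * ω ^ 14 * (x ^ 1 * y ^ 5) + c 2 * ω ^ 16 * (x ^ 2 * y ^ 4) + c 3 * ω ^ 18 * (x ^ 3 * y ^
        3) + c 4 * ω ^ 20 * (x ^ 4 * y ^ 2) + c 5 * ω ^ 22 * (x ^ 5 * y ^ 1) + c 6 * ω ^ 24 * (x ^
        6 * y ^ 0) := by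
      rw [hc]
      simp only [Finset.sum_range_succ, Finset.sum_range_zero]
      ring
    have p₀ := hc x y
    simp only [Finset.sum_range_succ, Finset.sum_range_zero] at p₀
    simp only [pow_eq_pow_mod _ hω3, Nat.reduceMod] at p₁ p₂
    -- Summing over the three powers of `quatC` cancels, by 1 + ω + ω² = 0, the terms whose
    -- exponents are not multiples of 3.
    have e : 3 * (evalAt ![x, y] f - (c 0 * y ^ 6 + c 3 * x ^ 3 * y ^ 3 + c 6 * x ^ 6)) = 0 := by
      linear_combination p₀ + p₁ + p₂ - 2 * h₁ - h₂ + (c 1 * x * y ^ 5 + c 2 * x ^ 2 * y ^ 4 +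
        c 4 * x ^ 4 * y ^ 2 + c 5 * x ^ 5 * y) * hω
    exact sub_eq_zero.1 ((mul_eq_zero.1 e).resolve_left h3)
  have i₁ := evalAt_of_mem_invariants hf quatI ![1, 0]
  have i₂ := evalAt_of_mem_invariants hf quatI ![0, 1]
  rw [planeRep_quatI, cubes, cubes] at i₁ i₂
  rw [cubes, cubes]
  have ht6 : 27 * t ^ 6 = -1 := by linear_combination (9 * t ^ 4 - 3 * t ^ 2 + 1) * ht'
  have hμ6 : 8 * μ ^ 6 = -1 := by linear_combination (4 * μ ^ 4 - 2 * μ ^ 2 + 1) * hμ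
  have h36 : (36 : F) ≠ 0 := by
    rw [show (36 : F) = 2 ^ 2 * 3 ^ 2 by norm_num]
    exact mul_ne_zero (pow_ne_zero 2 h2) (pow_ne_zero 2 h3)
  -- The images of (1, 0) and (0, 1) under `quatI` are (t, t) and (2t, -t), so `c 3` drops out of 8
  -- * i₁ + i₂.
  have e : 36 * (8 * c 6 + c 0) = 0 := by
    linear_combination (9 * c 0 + 72 * c 6) * ht6 - 27 * (8 * i₁ + i₂)
  have e' := (mul_eq_zero.1 e).resolve_left h36
  linear_combination c 6 * hμ6 - μ ^ 6 * e'

include hω in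
theorem evalAt_eq_of_degree_le (h3 : (3 : F) ≠ 0) {μ : F} (hμ : 2 * μ ^ 2 = -1)
    {f : CoordRing F (Fin 2 → F)} (hf : f ∈ invariants (planeRep h2 hω ht ht')) {d : ℕ}
    (hd : d ≤ 11) (hfd : f ∈ homogeneousPart F (Fin 2 → F) d) :
    evalAt ![1, 0] f = evalAt ![0, μ] f := by
  rcases Nat.eq_zero_or_pos d with rfl | hpos
  · rw [homogeneousPart, pow_zero] at hfd
    obtain ⟨r, rfl⟩ := Submodule.mem_one.1 hfd
    rw [AlgHom.commutes, AlgHom.commutes]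
  -- Both points are eigenvectors of `quatC` with eigenvalues ω² and ω, so both values vanish unless
  -- 3 divides `d`. In odd degree -1 makes every value vanish. Only degree 6 remains.
  by_cases h3d : 3 ∣ d
  · rcases Nat.even_or_odd d with heven | hodd
    · have : d = 6 := by
        obtain ⟨k, rfl⟩ := heven
        omega
      subst this
      exact evalAt_eq_of_degree_six h2 hω ht ht' h3 hμ hf hfd
    · have vanish : ∀ v, evalAt v f = 0 := by
        intro v
        have hv : planeRep h2 hω ht ht' (quatI * quatI) v = (-1 : F) • v := by
          have e : v = ![v 0, v 1] := by ext i; fin_cases i <;> rfl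
          rw [e, map_mul, Module.End.mul_apply, planeRep_quatI, planeRep_quatI]
          ext i
          fin_cases i
          · simp
            linear_combination v 0 * ht'
          · simp
            linear_combination v 1 * ht'
        have := evalAt_of_mem_invariants hf (quatI * quatI) v
        rw [hv, evalAt_smul hfd, hodd.neg_one_pow] at this
        exact (mul_eq_zero.1 (show 2 * evalAt v f = 0 by linear_combination -this)).resolve_left h2
      rw [vanish, vanish]
  · have h₁ := evalAt_of_mem_invariants hf quatC ![1, 0]
    have h₂ := evalAt_of_mem_invariants hf quatC ![0, μ]
    have e₁ : ![ω ^ 2 * 1, ω * 0] = ω ^ 2 • ![1, 0] := by simp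
    have e₂ : ![ω ^ 2 * 0, ω * μ] = ω • ![0, μ] := by simp
    rw [planeRep_quatC, e₁, evalAt_smul hfd, ← pow_mul] at h₁
    rw [planeRep_quatC, e₂, evalAt_smul hfd] at h₂
    rw [eq_zero_of_eq_pow_mul hω h3 (by omega) h₁.symm, eq_zero_of_eq_pow_mul hω h3 h3d h₂.symm]

theorem twelve_le_betaModule_planeRep (h3 : (3 : F) ≠ 0) {μ : F} (hμ : 2 * μ ^ 2 = -1) :
    12 ≤ betaModule (planeRep h2 hω ht ht') := by
  refine le_iInf₂ fun d hd => ?_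
  by_contra hlt
  have hlt : d < 12 := by
    rw [not_le] at hlt
    exact_mod_cast hlt
  have hle : invariants (planeRep h2 hω ht ht') ≤ AlgHom.equalizer (evalAt ![1, 0])
      (evalAt ![0, μ]) := by
    rw [← hd]
    refine Algebra.adjoin_le ?_
    rintro f ⟨hf, i, hi, hfi⟩
    exact evalAt_eq_of_degree_le h2 hω ht ht' h3 hμ hf (by omega) hfi
  have h : evalAt ![1, 0] (quartic F ^ 3) = evalAt ![0, μ] (quartic F ^ 3) :=
    hle (quartic_cube_mem_invariants h2 hω ht ht')
  rw [map_pow, map_pow, evalAt_quartic, evalAt_quartic] at h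
  -- The quartic is 0 at (1, 0) and -μ⁴ at (0, μ).
  have hμ0 : μ ^ 12 = 0 := by linear_combination h
  rw [pow_eq_zero_iff (by norm_num)] at hμ0
  rw [hμ0] at hμ
  norm_num at hμ

end LowerBound

theorem twelve_le_beta_binaryTetrahedral {F : Type u} [Field F] [IsAlgClosed F]
    (h2 : (2 : F) ≠ 0) (h3 : (3 : F) ≠ 0) : 12 ≤ beta F binaryTetrahedral := by
  -- With s² = -3 one takes ω = (s - 1)/2 and t = s/3.
  obtain ⟨s, hs⟩ := IsAlgClosed.exists_pow_nat_eq (-3 : F) (n := 2) (by norm_num)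
  obtain ⟨μ, hμ⟩ := IsAlgClosed.exists_pow_nat_eq (-1 / 2 : F) (n := 2) (by norm_num)
  have hω : ((s - 1) / 2) ^ 2 + (s - 1) / 2 + 1 = 0 := by
    field_simp
    linear_combination hs
  have ht : 3 * (s / 3) = 2 * ((s - 1) / 2) + 1 := by
    field_simp
    ring
  have ht' : 3 * (s / 3) ^ 2 = -1 := by
    field_simp
    linear_combination hs
  have hμ' : 2 * μ ^ 2 = -1 := by
    rw [hμ]
    field_simp
  refine (twelve_le_betaModule_planeRep h2 hω ht ht' h3 hμ').trans ?_
  exact le_iSup_of_le (Fin 2 → F) (le_iSup_of_le _ (le_iSup_of_le _ (le_iSup_of_le inferInstance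
    (le_iSup (fun ρ : Representation F binaryTetrahedral (Fin 2 → F) => betaModule ρ) _))))

end NoetherNumber

end

theorem corollary3p5 {F : Type*} [Field F] [IsAlgClosed F]
    (h2 : ringChar F ≠ 2) (h3 : ringChar F ≠ 3) :
    NoetherNumber.beta F NoetherNumber.binaryTetrahedral = 12 := by
  have h2' : (2 : F) ≠ 0 := Ring.two_ne_zero h2
  have h3' : (3 : F) ≠ 0 := by
    intro h
    have hd : ringChar F ∣ 3 := ringChar.dvd (by exact_mod_cast h)
    rcases (Nat.dvd_prime Nat.prime_three).1 hd with h1 | h1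
    · exact CharP.ringChar_ne_one h1
    · exact h3 h1
  exact le_antisymm (NoetherNumber.beta_binaryTetrahedral_le h2' h3')
    (NoetherNumber.twelve_le_beta_binaryTetrahedral h2' h3')
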